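/- Time is divided into slots indexed by $\mathbb N$, and $n$ identical parties contend for one shared resource. An oblivious adversary fixes in advance the wake-up times $t_u\in\mathbb N$ of the $n$ parties. A (LocalClock) protocol $\mathcal D$ is a probability distribution on infinite bit strings $X=(X_1,X_2,\dots)$, not depending on $n$; it is memoryless if the bits $X_1,X_2,\dots$ are mutually independent. Each party $u$ draws its own independent string $X^{(u)}\sim\mathcal D$, and attempts to grab the resource at time $t>t_u$ iff $X^{(u)}_{t-t_u}=1$ and $u$ has not succeeded before time $t$; it receives no feedback other than the acknowledgment of its own success. Party $u$ succeeds at time $t$ iff it is the only party that attempts at time $t$. The latency of $u$ is (time of success of $u$) $-\,t_u$, which is $\infty$ if $u$ never succeeds. Let $L^{\exp}_{\mathcal D}(n)\in[0,\infty]$ be the supremum, over all wake-up schedules of $n$ parties and all parties $u$, of the expected latency of $u$. Let $L^{\mathrm{whp}}_{\mathcal D}(n)\in\mathbb N\cup\{\infty\}$ be the least $L$ such that, for every wake-up schedule of $n$ parties and every party $u$, the latency of $u$ is at most $L$ with probability at least $1-n^{-2}$. Theorem. There is no memoryless acknowledgment-based LocalClock protocol $\mathcal D$ for which both $$L^{\exp}_{\mathcal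 D}(n)=o\!\left(\frac{n\log^2 n}{(\log\log n)^2}\right)\qquad\text{and}\qquad L^{\mathrm{whp}}_{\mathcal D}(n)\le n\log^{O(1)}n$$ hold as $n\to\infty$ (the second meaning that for some constant $C$, $L^{\mathrm{whp}}_{\mathcal D}(n)\le n\log^{C}n$ for all sufficiently large $n$). -/

import Mathlib

open MeasureTheory ProbabilityTheory Filter
open scoped ENNReal

noncomputable section

namespace ContentionResolution

/-- A protocol in the LocalClock model: a probability distribution over infinite bit strings
`X₁ X₂ X₃ …`.  The bit `X_{i+1}`, telling whether the party tries to grab the resource at local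
time `i + 1`, is stored as `x i` (a party does nothing at local time `0`). -/
abbrev LocalClockProtocol : Type := ProbabilityMeasure (ℕ → Bool)

/-- A protocol is memoryless if the decision at each local time is independent of the
decisions at all other local times, i.e. the bits are mutually independent, so that the
protocol is described by the numbers `p(i) = Pr[X_i = 1]`. -/
def LocalClockProtocol.IsMemoryless (D : LocalClockProtocol) : Prop :=
  iIndepFun (fun (i : ℕ) (x : ℕ → Bool) => x i) (D : Measure (ℕ → Bool))

/-- An oblivious adversary that wakes up exactly `n` parties: it fixes in advance the global
wake-up time of each of the `n` parties. -/
abbrev Schedule (n : ℕ) : Type := Fin n → ℕ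

/-- A party with bit string `x` that is woken up at global time `w`, and is still in the system,
attempts to grab the resource at global time `t`. -/
def Attempts (x : ℕ → Bool) (w t : ℕ) : Prop :=
  ∃ i : ℕ, t = w + (i + 1) ∧ x i = true

/-- If `S` is the set of parties that succeeded before global time `t`, then `u` achieves success
at time `t` iff `u` is still in the system and is the only remaining party that attempts to grab
the resource at time `t`. -/
def SoleAttempt {n : ℕ} (w : Schedule n) (x : Fin n → ℕ → Bool) (S : Set (Fin n))
    (t : ℕ) (u : Fin n) : Prop :=
  u ∉ S ∧ Attempts (x u) (w u) t ∧ ∀ v : Fin n, v ∉ S → Attempts (x v) (w v) t → v = u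

/-- The set of parties that achieve success strictly before global time `t`. -/
def succeededBefore {n : ℕ} (w : Schedule n) (x : Fin n → ℕ → Bool) : ℕ → Set (Fin n)
  | 0 => ∅
  | t + 1 => succeededBefore w x t ∪ {u | SoleAttempt w x (succeededBefore w x t) t u}

/-- Party `u` achieves success at global time `t`. -/
def SucceedsAt {n : ℕ} (w : Schedule n) (x : Fin n → ℕ → Bool) (t : ℕ) (u : Fin n) : Prop :=
  SoleAttempt w x (succeededBefore w x t) t u

/-- The latency of party `u`: the time from its wake-up to its success, `⊤` if it never
succeeds. -/
def latency {n : ℕ} (w : Schedule n) (x : Fin n → ℕ → Bool) (u : Fin n) : ℕ∞ :=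
  ⨅ (l : ℕ) (_ : SucceedsAt w x (w u + l) u), (l : ℕ∞)

/-- The law of the bit strings of `n` parties which run `D` independently. -/
def execution (D : LocalClockProtocol) (n : ℕ) : Measure (Fin n → ℕ → Bool) :=
  Measure.pi fun _ : Fin n => (D : Measure (ℕ → Bool))

/-- Expected latency: the supremum over all oblivious adversaries waking up `n` parties, and
over all parties, of the expected latency of the party. -/
def expLatency (D : LocalClockProtocol) (n : ℕ) : ℝ≥0∞ :=
  ⨆ (w : Schedule n) (u : Fin n), ∫⁻ x, ((latency w x u : ℕ∞) : ℝ≥0∞) ∂(execution D n)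

/-- The least `L` such that, against every oblivious adversary waking up `n` parties, each party
has latency at most `L` with probability at least `1 - q`. -/
def latencyBound (D : LocalClockProtocol) (n : ℕ) (q : ℝ) : ℕ∞ :=
  sInf {L : ℕ∞ | ∀ (w : Schedule n) (u : Fin n),
    1 - q ≤ (execution D n).real {x | latency w x u ≤ L}}

/-- Latency with high probability: the failure probability is `n⁻²`. -/
def whpLatency (D : LocalClockProtocol) (n : ℕ) : ℕ∞ :=
  latencyBound D n (((n : ℝ) ^ 2)⁻¹)

/-- `L(n) = o(f(n))` for a function `L` that may take the value `∞`. -/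
def IsLittleOTop (L : ℕ → ℝ≥0∞) (f : ℕ → ℝ) : Prop :=
  ∀ ε : ℝ, 0 < ε → ∀ᶠ n : ℕ in atTop, L n ≤ ENNReal.ofReal (ε * f n)

/-- `L(n) = n log^{O(1)} n`, as an upper bound on `L`. -/
def IsNPolylog (L : ℕ → ℝ≥0∞) : Prop :=
  ∃ C : ℝ, ∀ᶠ n : ℕ in atTop, L n ≤ ENNReal.ofReal ((n : ℝ) * (Real.log n) ^ C)

end ContentionResolution

end

noncomputable section

namespace ContentionResolution


/-! Write p(i) for `bitProb D i`, i₀ for the first index with p(i₀) > 0, and b for log q rounded up,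
where n = q⁴. Both assumptions are tested with adversaries built from fresh parties: a party almost
surely makes no attempt before index i₀, so it is still present at that index. Polylogarithmically
many parties woken together therefore make one chosen slot noisy.

Blocking. With y·polylog parties the adversary can spoil a party's first y local times and all its
heavy ones (p(i) > b⁻²), which are few. The high-probability bound then forces the remaining light
attempts, up to local time y·b^d, to total about log n (`exists_blocking_schedule`,
`log_sub_one_le_sum`). About b/(d log b) such ranges fit between q and q², so the light attempts
below q² total σ ≥ b²/(8 d log b).

Flooding. About n/2 parties woken at random times in [0, T) give light contention of order nσ/T at
every time, while fresh parties cover the initial times. If contention stays at least R, a party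
succeeds by T with probability at most e^(1-R)·s, where s is the sum of all p(i) with i < T. When s
is polylogarithmic, R = 8 log b suffices, and T of order nσ/R, hence n log²n/(log log n)²,
contradicts the first assumption.

Departures lower the contention and depend on each other, so they are controlled by an exponential
moment of the set of departed parties (`expectedWeight_le`, `success_prob_le`). Lightness is
essential here: it permits the rate θ = b², and e^(-θR/2) beats a union bound over T times although
R is only of order log log n.

That s is polylogarithmic comes from a cruder flooding with θ = 1 and R = 20b
(`eventually_sum_bitProb_le`). -/

/-- The probability that the bit with index `i` is set. -/
def bitProb (D : LocalClockProtocol) (i : ℕ) : ℝ :=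
  (D : Measure (ℕ → Bool)).real {x | x i = true}

lemma bitProb_nonneg (D : LocalClockProtocol) (i : ℕ) : 0 ≤ bitProb D i := measureReal_nonneg

lemma bitProb_le_one (D : LocalClockProtocol) (i : ℕ) : bitProb D i ≤ 1 := measureReal_le_one

/-! ### Independence of the bits -/

instance (D : LocalClockProtocol) (n : ℕ) : IsProbabilityMeasure (execution D n) := by
  unfold execution; infer_instance

lemma measurable_bit {n : ℕ} (v : Fin n) (i : ℕ) :
    Measurable fun x : Fin n → ℕ → Bool => x v i := by fun_prop

/-- The product measure gives independence across parties and memorylessness gives it within a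
party; uncurrying joins the two. -/
lemma iIndepFun_bits {D : LocalClockProtocol} (hD : D.IsMemoryless) (n : ℕ) :
    iIndepFun (fun (b : Fin n × ℕ) (x : Fin n → ℕ → Bool) => x b.1 b.2) (execution D n) := by
  refine iIndepFun_uncurry' (X := fun v i (x : Fin n → ℕ → Bool) => x v i)
    (fun v i => measurable_bit v i) ?_ ?_
  · exact iIndepFun_pi (μ := fun _ : Fin n => (D : Measure (ℕ → Bool)))
      (X := fun _ x => x) (fun _ => aemeasurable_id)
  · intro v
    have hmp := measurePreserving_eval (fun _ : Fin n => (D : Measure (ℕ → Bool))) v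
    have h := hD
    unfold LocalClockProtocol.IsMemoryless at h
    rw [iIndepFun_iff_measure_inter_preimage_eq_mul] at h ⊢
    intro S sets hs
    have key : ∀ A : Set (ℕ → Bool), MeasurableSet A →
        execution D n ((fun x => x v) ⁻¹' A) = (D : Measure (ℕ → Bool)) A := fun A hA =>
      hmp.measure_preimage hA.nullMeasurableSet
    have := h S hs
    rw [← key _ (Finset.measurableSet_biInter _ fun i hi => (measurable_pi_apply i) (hs i hi))] at this
    rw [Finset.prod_congr rfl fun i hi => (key _ ((measurable_pi_apply i) (hs i hi))).symm] at this
    simpa [Set.preimage_iInter, Set.preimage_preimage] using this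

lemma execution_bit_true (D : LocalClockProtocol) {n : ℕ} (v : Fin n) (i : ℕ) :
    (execution D n).real {x | x v i = true} = bitProb D i := by
  have hmp := measurePreserving_eval (fun _ : Fin n => (D : Measure (ℕ → Bool))) v
  have hA : MeasurableSet {x : ℕ → Bool | x i = true} :=
    measurableSet_eq_fun (measurable_pi_apply i) measurable_const
  have := hmp.measure_preimage hA.nullMeasurableSet
  simp only [Measure.real, bitProb, execution]
  rw [← this]; rfl

lemma execution_bit_false (D : LocalClockProtocol) {n : ℕ} (v : Fin n) (i : ℕ) :
    (execution D n).real {x | x v i = false} = 1 - bitProb D i := by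
  have hA : MeasurableSet {x : Fin n → ℕ → Bool | x v i = true} :=
    measurableSet_eq_fun (measurable_bit v i) measurable_const
  rw [← execution_bit_true D v i, ← probReal_compl_eq_one_sub hA]
  congr 1; ext x; simp

lemma execution_cylinder {D : LocalClockProtocol} (hD : D.IsMemoryless) {n : ℕ}
    (F : Finset (Fin n × ℕ)) (β : Fin n × ℕ → Bool) :
    (execution D n).real {x | ∀ b ∈ F, x b.1 b.2 = β b}
      = ∏ b ∈ F, if β b = true then bitProb D b.2 else 1 - bitProb D b.2 := by
  have h := (iIndepFun_bits hD n).measure_inter_preimage_eq_mul F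
    (sets := fun b => {β b}) (fun b _ => measurableSet_singleton _)
  have e : {x : Fin n → ℕ → Bool | ∀ b ∈ F, x b.1 b.2 = β b}
      = ⋂ b ∈ F, (fun x : Fin n → ℕ → Bool => x b.1 b.2) ⁻¹' {β b} := by ext x; simp
  rw [Measure.real, e, h, ENNReal.toReal_prod]
  refine Finset.prod_congr rfl fun b _ => ?_
  cases hb : β b
  · simp only [Bool.false_eq_true, if_false]
    exact execution_bit_false D b.1 b.2
  · simp only [if_true]
    exact execution_bit_true D b.1 b.2

/-- The σ-algebra generated by a set of bits. -/
abbrev bitAlgebra {n : ℕ} (F : Set (Fin n × ℕ)) : MeasurableSpace (Fin n → ℕ → Bool) :=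
  ⨆ b ∈ F, MeasurableSpace.comap (fun x : Fin n → ℕ → Bool => x b.1 b.2) inferInstance

lemma bitAlgebra_le {n : ℕ} (F : Set (Fin n × ℕ)) :
    bitAlgebra F ≤ (inferInstance : MeasurableSpace (Fin n → ℕ → Bool)) :=
  iSup₂_le fun b _ => (measurable_bit b.1 b.2).comap_le

lemma bitAlgebra_mono {n : ℕ} {F G : Set (Fin n × ℕ)} (h : F ⊆ G) :
    bitAlgebra F ≤ bitAlgebra G := biSup_mono h

lemma measurableSet_bit {n : ℕ} {F : Set (Fin n × ℕ)} {b : Fin n × ℕ} (hb : b ∈ F) (c : Bool) :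
    MeasurableSet[bitAlgebra F] {x : Fin n → ℕ → Bool | x b.1 b.2 = c} :=
  le_iSup₂_of_le (f := fun (b : Fin n × ℕ) (_ : b ∈ F) => MeasurableSpace.comap
    (fun x : Fin n → ℕ → Bool => x b.1 b.2) inferInstance) b hb le_rfl _
    ⟨{c}, measurableSet_singleton c, rfl⟩

lemma execution_inter_of_disjoint {D : LocalClockProtocol} (hD : D.IsMemoryless) {n : ℕ}
    {F G : Set (Fin n × ℕ)} (hFG : Disjoint F G) {A B : Set (Fin n → ℕ → Bool)}
    (hA : MeasurableSet[bitAlgebra F] A) (hB : MeasurableSet[bitAlgebra G] B) :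
    (execution D n).real (A ∩ B) = (execution D n).real A * (execution D n).real B := by
  have := indep_iSup_of_disjoint (fun b : Fin n × ℕ => (measurable_bit b.1 b.2).comap_le)
    ((iIndepFun_iff_iIndep _ _ _).1 (iIndepFun_bits hD n)) hFG
  rw [Indep_iff] at this
  simp only [Measure.real, this A B hA hB, ENNReal.toReal_mul]

/-! ### Attempts at a fixed time and measurability of the state -/

/-- The probability that party `v`, if still in the system, attempts at global time `t`. -/
def attemptProb (D : LocalClockProtocol) {n : ℕ} (w : Schedule n) (t : ℕ) (v : Fin n) : ℝ :=
  if w v < t then bitProb D (t - w v - 1) else 0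

lemma attemptProb_nonneg (D : LocalClockProtocol) {n : ℕ} (w : Schedule n) (t : ℕ) (v : Fin n) :
    0 ≤ attemptProb D w t v := by
  unfold attemptProb; split_ifs; exacts [bitProb_nonneg _ _, le_rfl]

lemma attemptProb_le_one (D : LocalClockProtocol) {n : ℕ} (w : Schedule n) (t : ℕ) (v : Fin n) :
    attemptProb D w t v ≤ 1 := by
  unfold attemptProb; split_ifs; exacts [bitProb_le_one _ _, zero_le_one]

lemma attempts_iff {x : ℕ → Bool} {w t : ℕ} : Attempts x w t ↔ w < t ∧ x (t - w - 1) = true := by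
  constructor
  · rintro ⟨i, rfl, h⟩
    refine ⟨by omega, ?_⟩
    rwa [show w + (i + 1) - w - 1 = i by omega]
  · rintro ⟨h, hx⟩
    exact ⟨_, by omega, hx⟩

/-- The bits that decide about attempts before time `t`. -/
def pastBits {n : ℕ} (w : Schedule n) (t : ℕ) : Set (Fin n × ℕ) := {b | w b.1 + b.2 + 1 < t}

/-- The bits that decide about attempts at time `t`. -/
def presentBits {n : ℕ} (w : Schedule n) (t : ℕ) : Set (Fin n × ℕ) := {b | w b.1 + b.2 + 1 = t}

lemma disjoint_past_present {n : ℕ} (w : Schedule n) (t : ℕ) :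
    Disjoint (pastBits w t) (presentBits w t) := by
  rw [Set.disjoint_left]; intro b hb hb'
  simp only [pastBits, presentBits, Set.mem_ofPred_eq] at hb hb'; omega

lemma measurableSet_attempts {n : ℕ} (w : Schedule n) (t : ℕ) (v : Fin n) {F : Set (Fin n × ℕ)}
    (hF : presentBits w t ⊆ F) :
    MeasurableSet[bitAlgebra F] {x : Fin n → ℕ → Bool | Attempts (x v) (w v) t} := by
  simp only [attempts_iff]
  by_cases h : w v < t
  · simp only [h, true_and]
    refine measurableSet_bit (b := (v, t - w v - 1)) (hF ?_) true
    simp only [presentBits, Set.mem_ofPred_eq]; omega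
  · simp only [h, false_and]
    exact @MeasurableSet.empty _ (bitAlgebra F)

lemma measurableSet_soleAttempt {n : ℕ} (w : Schedule n) (t : ℕ) (u : Fin n) (S : Set (Fin n))
    {F : Set (Fin n × ℕ)} (hF : presentBits w t ⊆ F) :
    MeasurableSet[bitAlgebra F] {x : Fin n → ℕ → Bool | SoleAttempt w x S t u} := by
  let _ : MeasurableSpace (Fin n → ℕ → Bool) := bitAlgebra F
  have h := fun v => measurableSet_attempts w t v hF
  have e : {x : Fin n → ℕ → Bool | SoleAttempt w x S t u} = {_x | u ∉ S} ∩
      ({x | Attempts (x u) (w u) t} ∩ ⋂ v, {_x | v ∈ S ∨ v = u} ∪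
        {x | Attempts (x v) (w v) t}ᶜ) := by
    ext x
    simp only [SoleAttempt, Set.mem_ofPred_eq, Set.mem_inter_iff, Set.mem_iInter, Set.mem_union,
      Set.mem_compl_iff]
    refine and_congr_right fun _ => and_congr_right fun _ => forall_congr' fun v => ?_
    tauto
  rw [e]
  exact (MeasurableSet.const _).inter ((h u).inter
    (MeasurableSet.iInter fun v => (MeasurableSet.const _).union (h v).compl))

-- The state at time t is a function of the bits read before t, hence independent of the attempts at
-- t. This replaces conditioning on the history.
open Classical in
lemma measurableSet_succeededBefore_eq {n : ℕ} (w : Schedule n) (t : ℕ) :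
    ∀ S : Set (Fin n), MeasurableSet[bitAlgebra (pastBits w t)]
      {x : Fin n → ℕ → Bool | succeededBefore w x t = S} := by
  induction t with
  | zero =>
    intro S
    exact @MeasurableSet.const _ (bitAlgebra (pastBits w 0)) (∅ = S)
  | succ t ih =>
    intro S
    have hle := bitAlgebra_mono (show pastBits w t ⊆ pastBits w (t + 1) from
      fun b hb => by simp only [pastBits, Set.mem_ofPred_eq] at *; omega)
    have hp : presentBits w t ⊆ pastBits w (t + 1) := fun b hb => by
      simp only [pastBits, presentBits, Set.mem_ofPred_eq] at *; omega
    let _ : MeasurableSpace (Fin n → ℕ → Bool) := bitAlgebra (pastBits w (t + 1))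
    have e : {x : Fin n → ℕ → Bool | succeededBefore w x (t + 1) = S} =
        ⋃ S' : Set (Fin n), {x | succeededBefore w x t = S'} ∩
          ⋂ v, if v ∈ S then {_x | v ∈ S'} ∪ {x | SoleAttempt w x S' t v}
            else {_x | v ∉ S'} ∩ {x | SoleAttempt w x S' t v}ᶜ := by
      ext x
      have key : ∀ (S' : Set (Fin n)) (v : Fin n),
          (x ∈ if v ∈ S then {_x | v ∈ S'} ∪ {x | SoleAttempt w x S' t v}
            else {_x | v ∉ S'} ∩ {x | SoleAttempt w x S' t v}ᶜ) ↔
          (v ∈ S' ∪ {u | SoleAttempt w x S' t u} ↔ v ∈ S) := by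
        intro S' v
        split_ifs with h <;> simp [h]
      simp only [Set.mem_ofPred_eq, Set.mem_iUnion, Set.mem_inter_iff, Set.mem_iInter, key]
      constructor
      · intro h; exact ⟨_, rfl, fun v => Set.ext_iff.1 h v⟩
      · rintro ⟨S', rfl, h2⟩
        exact Set.ext h2
    rw [e]
    refine MeasurableSet.iUnion fun S' => (hle _ (ih S')).inter (MeasurableSet.iInter fun v => ?_)
    split_ifs
    · exact (MeasurableSet.const _).union (measurableSet_soleAttempt w t v S' hp)
    · exact (MeasurableSet.const _).inter (measurableSet_soleAttempt w t v S' hp).compl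

lemma succeededBefore_mono {n : ℕ} (w : Schedule n) (x : Fin n → ℕ → Bool) :
    Monotone (succeededBefore w x) :=
  monotone_nat_of_le_succ fun _ => Set.subset_union_left

/-! ### Contention bounds the chance of success -/

/-- The total attempt probability at time `t` of the parties outside `S`. -/
def contention (D : LocalClockProtocol) {n : ℕ} (w : Schedule n) (t : ℕ) (S : Set (Fin n)) : ℝ :=
  by classical exact ∑ v with v ∉ S, attemptProb D w t v

/-- If u is present and awake, the probability is p_u times the product of 1 - p_v over the other
remaining parties, and 1 - p ≤ e^(-p). The 1 in the exponent pays for p_u ≤ 1, which belongs to the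
contention but not to that product. -/
lemma soleAttempt_prob_le {D : LocalClockProtocol} (hD : D.IsMemoryless) {n : ℕ}
    (w : Schedule n) (t : ℕ) (u : Fin n) (S : Set (Fin n)) :
    (execution D n).real {x | SoleAttempt w x S t u}
      ≤ attemptProb D w t u * Real.exp (1 - contention D w t S) := by
  classical
  by_cases hu : u ∈ S
  · simp only [SoleAttempt, hu, not_true_eq_false, false_and, Set.ofPred_false, measureReal_empty]
    exact mul_nonneg (attemptProb_nonneg _ _ _ _) (Real.exp_nonneg _)
  by_cases hw : w u < t
  swap
  · have : {x : Fin n → ℕ → Bool | SoleAttempt w x S t u} = ∅ := by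
      ext x; simp [SoleAttempt, attempts_iff, hw]
    rw [this, measureReal_empty]
    exact mul_nonneg (attemptProb_nonneg _ _ _ _) (Real.exp_nonneg _)
  set V : Finset (Fin n) := Finset.univ.filter fun v => v ∉ S ∧ w v < t with hV
  have huV : u ∈ V := by simp [hV, hu, hw]
  set g : Fin n → Fin n × ℕ := fun v => (v, t - w v - 1) with hg
  have hginj : Function.Injective g := fun a b h => (Prod.ext_iff.1 h).1
  have e : {x : Fin n → ℕ → Bool | SoleAttempt w x S t u} =
      {x | ∀ b ∈ V.image g, x b.1 b.2 = decide (b.1 = u)} := by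
    ext x
    simp only [SoleAttempt, attempts_iff, Set.mem_ofPred_eq, hu, not_false_eq_true, true_and,
      Finset.forall_mem_image, hV, Finset.mem_filter, Finset.mem_univ, hg]
    constructor
    · rintro ⟨⟨-, h1⟩, h2⟩ v ⟨hvS, hvt⟩
      by_cases hvu : v = u
      · subst hvu; simpa using h1
      · have := mt (h2 v hvS) hvu
        simpa [hvu, hvt] using this
    · intro h
      refine ⟨⟨hw, by simpa using h ⟨hu, hw⟩⟩, fun v hvS ⟨hvt, hx⟩ => ?_⟩
      have := h ⟨hvS, hvt⟩
      simpa [hx] using this.symm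
  rw [e, execution_cylinder hD, Finset.prod_image hginj.injOn,
    ← Finset.mul_prod_erase _ _ huV]
  have h1 : attemptProb D w t u = bitProb D (t - w u - 1) := by simp [attemptProb, hw]
  have hc : contention D w t S = ∑ v ∈ V, attemptProb D w t v := by
    unfold contention
    symm
    apply Finset.sum_subset
    · intro v; simp only [hV, Finset.mem_filter]; tauto
    · intro v hv hv'
      simp only [hV, Finset.mem_filter, Finset.mem_univ, true_and] at hv hv'
      simp [attemptProb]; tauto
  simp only [hg, decide_true, if_true, ← h1]
  refine mul_le_mul_of_nonneg_left ?_ (attemptProb_nonneg _ _ _ _)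
  have h2 : ∀ v ∈ V.erase u, (if decide (v = u) = true then bitProb D (t - w v - 1)
      else 1 - bitProb D (t - w v - 1)) ≤ Real.exp (- attemptProb D w t v) := by
    intro v hv
    simp only [Finset.mem_erase, hV, Finset.mem_filter] at hv
    rw [if_neg (by simpa using hv.1)]
    simp only [attemptProb, hv.2.2.2, if_true]
    have := Real.add_one_le_exp (-bitProb D (t - w v - 1)); linarith
  refine (Finset.prod_le_prod (fun v hv => ?_) h2).trans ?_
  · split_ifs
    · exact bitProb_nonneg _ _
    · linarith [bitProb_le_one D (t - w v - 1)]
  rw [← Real.exp_sum, Real.exp_le_exp, hc, Finset.sum_neg_distrib, ← Finset.add_sum_erase _ _ huV]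
  linarith [attemptProb_le_one D w t u]


/-! ### Exponential moments of the set of departed parties -/

lemma sum_measureReal_le_of_indicator {Ω ι κ : Type*} [MeasurableSpace Ω] (μ : Measure Ω)
    [IsFiniteMeasure μ] [Fintype ι] [Fintype κ] {A : ι → Set Ω} {B : κ → Set Ω} {c : ι → ℝ}
    {d : κ → ℝ} (hA : ∀ i, MeasurableSet (A i)) (hB : ∀ j, MeasurableSet (B j))
    (h : ∀ x, ∑ i, (A i).indicator (fun _ => c i) x ≤ ∑ j, (B j).indicator (fun _ => d j) x) :
    ∑ i, c i * μ.real (A i) ≤ ∑ j, d j * μ.real (B j) := by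
  have h1 : ∀ i, Integrable ((A i).indicator fun _ => c i) μ := fun i =>
    (integrable_const _).indicator (hA i)
  have h2 : ∀ j, Integrable ((B j).indicator fun _ => d j) μ := fun j =>
    (integrable_const _).indicator (hB j)
  have := integral_mono (integrable_finsetSum Finset.univ fun i _ => h1 i)
    (integrable_finsetSum Finset.univ fun j _ => h2 j) h
  rw [integral_finsetSum _ fun i _ => h1 i, integral_finsetSum _ fun j _ => h2 j] at this
  simpa [integral_indicator_const, hA, hB, mul_comm] using this

/-- All the states before time `t` satisfy `Good`. -/
def GoodUntil {n : ℕ} (Good : ℕ → Set (Fin n) → Prop) (w : Schedule n) (t : ℕ) :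
    Set (Fin n → ℕ → Bool) :=
  {x | ∀ t' < t, Good t' (succeededBefore w x t')}

lemma pastBits_mono {n : ℕ} (w : Schedule n) : Monotone (pastBits w) := fun s t h b hb => by
  simp only [pastBits, Set.mem_ofPred_eq] at *; omega

lemma measurableSet_state {n : ℕ} (w : Schedule n) (t : ℕ) (P : Set (Fin n) → Prop) :
    MeasurableSet[bitAlgebra (pastBits w t)]
      {x : Fin n → ℕ → Bool | P (succeededBefore w x t)} := by
  classical
  have e : {x : Fin n → ℕ → Bool | P (succeededBefore w x t)} =
      ⋃ S : {S : Set (Fin n) // P S}, {x | succeededBefore w x t = S} := by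
    ext x; simp
  rw [e]
  exact MeasurableSet.iUnion fun S => measurableSet_succeededBefore_eq w t S

lemma measurableSet_goodUntil {n : ℕ} (Good : ℕ → Set (Fin n) → Prop) (w : Schedule n) (t : ℕ) :
    MeasurableSet[bitAlgebra (pastBits w t)] (GoodUntil Good w t) := by
  have e : GoodUntil Good w t =
      ⋂ t' ∈ Finset.range t, {x | Good t' (succeededBefore w x t')} := by
    ext x; simp [GoodUntil]
  rw [e]
  exact Finset.measurableSet_biInter _ fun t' ht' =>
    bitAlgebra_mono (pastBits_mono w (Finset.mem_range.1 ht').le) _ (measurableSet_state w t' _)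

open Classical in
/-- The product of `1 + a v` over the parties `v` in `S`. -/
def stateWeight {n : ℕ} (a : Fin n → ℝ) (S : Set (Fin n)) : ℝ :=
  ∏ v, if v ∈ S then 1 + a v else 1

lemma stateWeight_nonneg {n : ℕ} {a : Fin n → ℝ} (ha : ∀ v, 0 ≤ a v) (S : Set (Fin n)) :
    0 ≤ stateWeight a S :=
  Finset.prod_nonneg fun v _ => by split_ifs; exacts [by linarith [ha v], zero_le_one]

lemma stateWeight_empty {n : ℕ} (a : Fin n → ℝ) : stateWeight a ∅ = 1 := by simp [stateWeight]

lemma stateWeight_union_singleton {n : ℕ} (a : Fin n → ℝ) (S : Set (Fin n)) {u : Fin n}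
    (hu : u ∉ S) : stateWeight a (S ∪ {u}) = stateWeight a S * (1 + a u) := by
  classical
  unfold stateWeight
  rw [← Finset.mul_prod_erase _ _ (Finset.mem_univ u),
    ← Finset.mul_prod_erase _ (fun v => if v ∈ S then 1 + a v else 1) (Finset.mem_univ u)]
  simp only [Set.mem_union, Set.mem_singleton_iff, or_true, if_true, hu, if_false, one_mul]
  rw [mul_comm]
  congr 1
  refine Finset.prod_congr rfl fun v hv => ?_
  simp [Finset.ne_of_mem_erase hv]

/-- The expectation of the weight of the state at time `t`, on the event that all earlier
states were good. -/
def expectedWeight (D : LocalClockProtocol) {n : ℕ} (Good : ℕ → Set (Fin n) → Prop)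
    (w : Schedule n) (a : Fin n → ℝ) (t : ℕ) : ℝ :=
  by classical exact ∑ S : Set (Fin n), stateWeight a S *
    (execution D n).real (GoodUntil Good w t ∩ {x | succeededBefore w x t = S})

/-- At most one party leaves per slot, so the weight gains a factor `1 + a u` exactly when u leaves.
For a fixed good state S this depends only on present bits, so its probability multiplies with that
of the past event. -/
lemma expectedWeight_succ_le {D : LocalClockProtocol} (hD : D.IsMemoryless) {n : ℕ}
    {Good : ℕ → Set (Fin n) → Prop} {w : Schedule n} {a : Fin n → ℝ} {ε : ℝ} {t : ℕ}
    (ha : ∀ v, 0 ≤ a v) (hε : 0 ≤ ε)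
    (hGood : ∀ S u, Good t S →
      (execution D n).real {x | SoleAttempt w x S t u} ≤ ε * attemptProb D w t u) :
    expectedWeight D Good w a (t + 1)
      ≤ (1 + ε * ∑ v, a v * attemptProb D w t v) * expectedWeight D Good w a t := by
  classical
  set μ := execution D n
  set B : Set (Fin n) → Set (Fin n → ℕ → Bool) := fun S =>
    GoodUntil Good w t ∩ {x | succeededBefore w x t = S} with hBdef
  have hBm' : ∀ S, MeasurableSet[bitAlgebra (pastBits w t)] (B S) := fun S =>
    MeasurableSet.inter (measurableSet_goodUntil Good w t) (measurableSet_succeededBefore_eq w t S)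
  have hBm : ∀ S, MeasurableSet (B S) := fun S => bitAlgebra_le _ _ (hBm' S)
  set Q : Set (Fin n) → Fin n → Set (Fin n → ℕ → Bool) := fun S u =>
    {x | SoleAttempt w x S t u} with hQdef
  have hQm' : ∀ S u, MeasurableSet[bitAlgebra (presentBits w t)] (Q S u) := fun S u =>
    measurableSet_soleAttempt w t u S subset_rfl
  have hQm : ∀ S u, MeasurableSet (Q S u) := fun S u => bitAlgebra_le _ _ (hQm' S u)
  set G : Set (Fin n) → Set (Fin n → ℕ → Bool) := fun S => if Good t S then B S else ∅ with hGdef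
  have hGm : ∀ S, MeasurableSet (G S) := fun S => by
    simp only [hGdef]; split_ifs; exacts [hBm S, MeasurableSet.empty]
  -- The index `none` carries the old weight, and `some u` the increment on the event that u leaves.
  have step1 : ∑ S : Set (Fin n), stateWeight a S *
      μ.real (GoodUntil Good w (t + 1) ∩ {x | succeededBefore w x (t + 1) = S}) ≤
      ∑ j : Set (Fin n) × Option (Fin n),
        (j.2.elim (stateWeight a j.1) fun u => stateWeight a j.1 * a u) *
          μ.real (j.2.elim (G j.1) fun u => G j.1 ∩ Q j.1 u) := by
    refine sum_measureReal_le_of_indicator μ (fun S => ?_) (fun j => ?_) (fun x => ?_)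
    · exact bitAlgebra_le _ _ (MeasurableSet.inter (measurableSet_goodUntil Good w (t + 1))
        (measurableSet_succeededBefore_eq w (t + 1) S))
    · rcases j with ⟨S, _ | u⟩
      · exact hGm S
      · exact (hGm S).inter (hQm S u)
    · have hnn : ∀ j : Set (Fin n) × Option (Fin n), 0 ≤ Set.indicator
          (j.2.elim (G j.1) fun u => G j.1 ∩ Q j.1 u)
          (fun _ => j.2.elim (stateWeight a j.1) fun u => stateWeight a j.1 * a u) x := by
        rintro ⟨S, _ | u⟩
        · exact Set.indicator_nonneg (fun _ _ => stateWeight_nonneg ha S) x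
        · exact Set.indicator_nonneg (fun _ _ => mul_nonneg (stateWeight_nonneg ha S) (ha u)) x
      by_cases hx : x ∈ GoodUntil Good w (t + 1)
      swap
      · rw [Finset.sum_eq_zero fun S _ => Set.indicator_of_notMem (fun h => hx h.1) _]
        exact Finset.sum_nonneg fun j _ => hnn j
      set S := succeededBefore w x t with hS
      have hxG : x ∈ G S := by
        have h1 : Good t S := hx t (Nat.lt_succ_self t)
        simp only [hGdef, h1, if_true]
        exact ⟨fun t' ht' => hx t' (ht'.trans (Nat.lt_succ_self t)), rfl⟩
      rw [Finset.sum_eq_single (succeededBefore w x (t + 1))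
        (fun S' _ hS' => Set.indicator_of_notMem (fun h => hS' h.2.symm) _)
        (fun h => absurd (Finset.mem_univ _) h), Set.indicator_of_mem (show x ∈ GoodUntil Good w (t + 1) ∩
          {y | succeededBefore w y (t + 1) = succeededBefore w x (t + 1)} from ⟨hx, rfl⟩)]
      have hnone : Set.indicator (G S) (fun _ => stateWeight a S) x = stateWeight a S :=
        Set.indicator_of_mem hxG _
      by_cases hu : ∃ u, SoleAttempt w x S t u
      · obtain ⟨u, hu⟩ := hu
        have hstate : succeededBefore w x (t + 1) = S ∪ {u} := by
          simp only [succeededBefore, ← hS]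
          congr 1
          ext v
          simp only [Set.mem_ofPred_eq, Set.mem_singleton_iff]
          exact ⟨fun hv => hu.2.2 v hv.1 hv.2.1, fun hv => hv ▸ hu⟩
        rw [hstate, stateWeight_union_singleton a S hu.1]
        have hsome : Set.indicator (G S ∩ Q S u) (fun _ => stateWeight a S * a u) x
            = stateWeight a S * a u :=
          Set.indicator_of_mem (show x ∈ G S ∩ Q S u from ⟨hxG, hu⟩) _
        have := Finset.sum_le_sum_of_subset_of_nonneg
          (Finset.subset_univ {(S, none), (S, some u)}) fun j _ _ => hnn j
        rw [Finset.sum_pair (by simp)] at this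
        rw [mul_one_add, ← hsome]
        nth_rw 1 [← hnone]
        exact this
      · have hstate : succeededBefore w x (t + 1) = S := by
          simp only [succeededBefore, ← hS]
          rw [Set.union_eq_left]
          intro v hv; exact absurd ⟨v, hv⟩ hu
        rw [hstate]
        have := Finset.single_le_sum (fun j _ => hnn j) (Finset.mem_univ (S, none))
        rw [← hnone]
        exact this
  refine step1.trans ?_
  rw [Fintype.sum_prod_type]
  unfold expectedWeight
  rw [Finset.mul_sum]
  refine Finset.sum_le_sum fun S _ => ?_
  rw [Fintype.sum_option]
  simp only [Option.elim]
  have hGB : μ.real (G S) ≤ μ.real (B S) := by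
    simp only [hGdef]; split_ifs
    · exact le_rfl
    · simp
  have hW := stateWeight_nonneg ha S
  have hGQ : ∀ u, μ.real (G S ∩ Q S u) ≤ ε * attemptProb D w t u * μ.real (B S) := by
    intro u
    by_cases hg : Good t S
    · simp only [hGdef, hg, if_true]
      rw [execution_inter_of_disjoint hD (disjoint_past_present w t) (hBm' S) (hQm' S u), mul_comm]
      exact mul_le_mul_of_nonneg_right (hGood S u hg) measureReal_nonneg
    · simp only [hGdef, hg, if_false, Set.empty_inter, measureReal_empty]
      exact mul_nonneg (mul_nonneg hε (attemptProb_nonneg _ _ _ _)) measureReal_nonneg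
  calc _ ≤ stateWeight a S * μ.real (B S) + ∑ u, stateWeight a S * a u *
        (ε * attemptProb D w t u * μ.real (B S)) :=
        add_le_add (mul_le_mul_of_nonneg_left hGB hW) (Finset.sum_le_sum fun u _ =>
          mul_le_mul_of_nonneg_left (hGQ u) (mul_nonneg hW (ha u)))
    _ = _ := by
        rw [add_mul, one_mul, Finset.mul_sum, Finset.sum_mul]
        refine congrArg₂ _ rfl (Finset.sum_congr rfl fun u _ => ?_)
        ring

lemma expectedWeight_nonneg (D : LocalClockProtocol) {n : ℕ} (Good : ℕ → Set (Fin n) → Prop)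
    (w : Schedule n) {a : Fin n → ℝ} (ha : ∀ v, 0 ≤ a v) (t : ℕ) :
    0 ≤ expectedWeight D Good w a t :=
  Finset.sum_nonneg fun S _ => mul_nonneg (stateWeight_nonneg ha S) measureReal_nonneg

/-- Iterates the one-step bound with 1 + y ≤ e^y. The result is what independent departures, of
probability at most ε times the expected number of attempts, would give. -/
lemma expectedWeight_le {D : LocalClockProtocol} (hD : D.IsMemoryless) {n : ℕ}
    {Good : ℕ → Set (Fin n) → Prop} {w : Schedule n} {a : Fin n → ℝ} {ε : ℝ}
    (ha : ∀ v, 0 ≤ a v) (hε : 0 ≤ ε)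
    (hGood : ∀ t S u, Good t S →
      (execution D n).real {x | SoleAttempt w x S t u} ≤ ε * attemptProb D w t u) (t : ℕ) :
    expectedWeight D Good w a t
      ≤ Real.exp (ε * ∑ v, a v * ∑ s ∈ Finset.range t, attemptProb D w s v) := by
  classical
  induction t with
  | zero =>
    unfold expectedWeight
    rw [Finset.sum_eq_single ∅]
    · simp only [stateWeight_empty, one_mul, Finset.range_zero, Finset.sum_empty, mul_zero,
        Finset.sum_const_zero, Real.exp_zero]
      exact measureReal_le_one
    · intro S _ hS
      have : {x : Fin n → ℕ → Bool | succeededBefore w x 0 = S} = ∅ := by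
        ext x; simpa [succeededBefore] using hS.symm
      simp [this]
    · simp
  | succ t ih =>
    refine (expectedWeight_succ_le hD ha hε (hGood t)).trans ?_
    set y := ε * ∑ v, a v * attemptProb D w t v
    have h1 : 1 + y ≤ Real.exp y := by linarith [Real.add_one_le_exp y]
    calc _ ≤ Real.exp y * Real.exp (ε * ∑ v, a v * ∑ s ∈ Finset.range t, attemptProb D w s v) :=
          mul_le_mul h1 ih (expectedWeight_nonneg D Good w ha t) (Real.exp_nonneg _)
      _ = _ := by
          rw [← Real.exp_add, ← mul_add, ← Finset.sum_add_distrib]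
          simp only [Finset.sum_range_succ]
          congr 2
          refine Finset.sum_congr rfl fun v _ => ?_
          ring

/-- Markov's inequality for the weight. -/
lemma measureReal_state_le {D : LocalClockProtocol} {n : ℕ}
    {Good : ℕ → Set (Fin n) → Prop} {w : Schedule n} {a : Fin n → ℝ} (ha : ∀ v, 0 ≤ a v)
    {P : Set (Fin n) → Prop} {M : ℝ} {t : ℕ} (hP : ∀ S, P S → M ≤ stateWeight a S) :
    M * (execution D n).real (GoodUntil Good w t ∩ {x | P (succeededBefore w x t)})
      ≤ expectedWeight D Good w a t := by
  classical
  have hm : ∀ S, MeasurableSet (GoodUntil Good w t ∩ {x | succeededBefore w x t = S}) := fun S =>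
    bitAlgebra_le _ _ (MeasurableSet.inter (measurableSet_goodUntil Good w t)
        (measurableSet_succeededBefore_eq w t S))
  have := sum_measureReal_le_of_indicator (execution D n) (ι := Unit) (c := fun _ => M)
    (A := fun _ => GoodUntil Good w t ∩ {x | P (succeededBefore w x t)})
    (B := fun S => GoodUntil Good w t ∩ {x | succeededBefore w x t = S})
    (d := fun S => stateWeight a S) (fun _ => bitAlgebra_le _ _
      (MeasurableSet.inter (measurableSet_goodUntil Good w t) (measurableSet_state w t P)))
    hm (fun x => by
      have hnn : ∀ S : Set (Fin n), 0 ≤ Set.indicator (GoodUntil Good w t ∩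
          {x | succeededBefore w x t = S}) (fun _ => stateWeight a S) x := fun S =>
        Set.indicator_nonneg (fun _ _ => stateWeight_nonneg ha S) x
      simp only [Finset.univ_unique, Finset.sum_singleton]
      by_cases hx : x ∈ GoodUntil Good w t ∩ {x | P (succeededBefore w x t)}
      · rw [Set.indicator_of_mem hx]
        refine (hP _ hx.2).trans ?_
        have h := Finset.single_le_sum (fun j _ => hnn j) (Finset.mem_univ (succeededBefore w x t))
        rwa [Set.indicator_of_mem (show x ∈ GoodUntil Good w t ∩
          {y | succeededBefore w y t = succeededBefore w x t} from ⟨hx.1, rfl⟩)] at h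
      · rw [Set.indicator_of_notMem hx]
        exact Finset.sum_nonneg fun S _ => hnn S)
  simpa [expectedWeight] using this

/-- Splitting by the first bad time keeps each piece inside `GoodUntil` at that time, where the
moment bound applies. -/
lemma goodUntil_compl_subset {n : ℕ} (Good : ℕ → Set (Fin n) → Prop) (w : Schedule n) (t : ℕ) :
    (GoodUntil Good w t)ᶜ ⊆ ⋃ s ∈ Finset.range t,
      (GoodUntil Good w s ∩ {x | ¬ Good s (succeededBefore w x s)}) := by
  classical
  intro x hx
  simp only [GoodUntil, Set.mem_compl_iff, Set.mem_ofPred_eq, not_forall] at hx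
  have h : ∃ s, s < t ∧ ¬ Good s (succeededBefore w x s) := by
    obtain ⟨s, h1, h2⟩ := hx; exact ⟨s, h1, h2⟩
  have hs := Nat.find_spec h
  simp only [Set.mem_iUnion, Finset.mem_range]
  refine ⟨Nat.find h, hs.1, fun t' ht' => ?_, hs.2⟩
  by_contra hc
  exact Nat.find_min h ht' ⟨ht'.trans hs.1, hc⟩


/-! ### Contention persists despite departures -/

/-- The value at time `t` of the sequence `g` started just after time `w`. -/
def delayed (g : ℕ → ℝ) (w t : ℕ) : ℝ := if w < t then g (t - w - 1) else 0

lemma delayed_nonneg {g : ℕ → ℝ} (hg : ∀ i, 0 ≤ g i) (w t : ℕ) : 0 ≤ delayed g w t := by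
  unfold delayed; split_ifs; exacts [hg _, le_rfl]

lemma sum_delayed_le {g : ℕ → ℝ} (hg : ∀ i, 0 ≤ g i) (w T : ℕ) :
    ∑ s ∈ Finset.range T, delayed g w s ≤ ∑ i ∈ Finset.range T, g i := by
  rcases le_total T (w + 1) with h | h
  · rw [Finset.sum_eq_zero]
    · exact Finset.sum_nonneg fun i _ => hg i
    · intro s hs
      have := Finset.mem_range.1 hs
      simp only [delayed]
      rw [if_neg (by omega)]
  · obtain ⟨d, rfl⟩ := Nat.exists_eq_add_of_le h
    rw [Finset.sum_range_add]
    have h0 : ∑ s ∈ Finset.range (w + 1), delayed g w s = 0 :=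
      Finset.sum_eq_zero fun s hs => by
        have := Finset.mem_range.1 hs
        simp only [delayed]
        rw [if_neg (by omega)]
    have h1 : ∀ i, delayed g w (w + 1 + i) = g i := fun i => by
      simp only [delayed]
      rw [if_pos (by omega), show w + 1 + i - w - 1 = i by omega]
    rw [h0, zero_add, Finset.sum_congr rfl fun i _ => h1 i]
    exact Finset.sum_le_sum_of_subset_of_nonneg
      (Finset.range_mono (by omega)) fun i _ _ => hg i

lemma exists_attempt_of_mem_succeededBefore {n : ℕ} {w : Schedule n} {x : Fin n → ℕ → Bool}
    {t : ℕ} {v : Fin n} (h : v ∈ succeededBefore w x t) :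
    ∃ i, w v + i + 1 < t ∧ x v i = true := by
  induction t with
  | zero => exact absurd h (Set.notMem_empty v)
  | succ t ih =>
    rcases h with h | h
    · obtain ⟨i, h1, h2⟩ := ih h
      exact ⟨i, by omega, h2⟩
    · obtain ⟨i, h1, h2⟩ := h.2.1
      exact ⟨i, by omega, h2⟩

/-- Success requires an earlier set bit. As `succeededBefore` is strict, only bits of index below i₀
matter up to and including time `w v + i₀ + 1`, the first possible attempt. -/
lemma measureReal_succeeded_by_first_attempt {D : LocalClockProtocol} {n : ℕ} {w : Schedule n}
    {i₀ : ℕ} (hi₀ : ∀ i < i₀, bitProb D i = 0) (v : Fin n) {t : ℕ} (ht : t ≤ w v + i₀ + 1) :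
    (execution D n).real {x | v ∈ succeededBefore w x t} = 0 := by
  refine le_antisymm ?_ measureReal_nonneg
  have hsub : {x : Fin n → ℕ → Bool | v ∈ succeededBefore w x t} ⊆
      ⋃ i ∈ Finset.range i₀, {x | x v i = true} := by
    intro x hx
    obtain ⟨i, h1, h2⟩ := exists_attempt_of_mem_succeededBefore hx
    simp only [Set.mem_iUnion, Finset.mem_range]
    exact ⟨i, by omega, h2⟩
  refine (measureReal_mono hsub (measure_ne_top _ _)).trans ((measureReal_biUnion_finset_le _ _).trans ?_)
  refine (Finset.sum_eq_zero fun i hi => ?_).le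
  rw [execution_bit_true, hi₀ i (Finset.mem_range.1 hi)]

/-- If at every time the contention is large, either because of parties that are about to make
their first attempt or because of many attempts of small probability, then each party is
unlikely to succeed. -/
lemma success_prob_le {D : LocalClockProtocol} (hD : D.IsMemoryless) {n : ℕ} {w : Schedule n}
    {i₀ T : ℕ} {θ R : ℝ} {g : ℕ → ℝ} (hi₀ : ∀ i < i₀, bitProb D i = 0)
    (hg : ∀ i, 0 ≤ g i) (hgp : ∀ i, g i ≤ bitProb D i) (hθ : 0 ≤ θ) (hgθ : ∀ i, θ * g i ≤ 1)
    (hR : 0 ≤ R)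
    (hw : ∀ t < T, t ≤ i₀ ∨
      (∃ B : Finset (Fin n), (∀ v ∈ B, w v + i₀ + 1 = t) ∧ R ≤ B.card * bitProb D i₀) ∨
      2 * R ≤ ∑ v, delayed g (w v) t)
    (hs : Real.exp (1 - R) * ∑ i ∈ Finset.range T, bitProb D i ≤ 1 / 16)
    (hT : T * Real.exp (-(θ * R / 2)) ≤ 1 / 4) (u : Fin n) :
    (execution D n).real {x | u ∈ succeededBefore w x T} ≤ 1 / 2 := by
  classical
  set μ := execution D n
  set s := ∑ i ∈ Finset.range T, bitProb D i with hs_def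
  set ε := Real.exp (1 - R) with hε
  have hε0 : 0 ≤ ε := Real.exp_nonneg _
  -- Up to time i₀ only null bits are read, so no contention is needed there.
  set Good : ℕ → Set (Fin n) → Prop := fun t S => R ≤ contention D w t S ∨ t ≤ i₀ with hGd
  have hGood : ∀ t S u, Good t S →
      μ.real {x | SoleAttempt w x S t u} ≤ ε * attemptProb D w t u := by
    intro t S u h
    refine (soleAttempt_prob_le hD w t u S).trans ?_
    rw [mul_comm]
    rcases h with h | h
    · exact mul_le_mul_of_nonneg_right (Real.exp_le_exp.2 (by linarith))
        (attemptProb_nonneg _ _ _ _)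
    · have : attemptProb D w t u = 0 := by
        simp only [attemptProb]
        split_ifs with h'
        · exact hi₀ _ (by omega)
        · rfl
      simp [this]
  have hsum : ∀ t ≤ T, ∀ v, ∑ s ∈ Finset.range t, attemptProb D w s v ≤ s := fun t ht v =>
    (sum_delayed_le (bitProb_nonneg D) (w v) t).trans
      (Finset.sum_le_sum_of_subset_of_nonneg (Finset.range_mono ht)
        fun i _ _ => bitProb_nonneg D i)
  have hbad : ∀ t < T, μ.real (GoodUntil Good w t ∩ {x | ¬ Good t (succeededBefore w x t)})
      ≤ Real.exp (-(θ * R / 2)) := by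
    intro t ht
    by_cases hti : t ≤ i₀
    · have : {x : Fin n → ℕ → Bool | ¬ Good t (succeededBefore w x t)} = ∅ := by
        ext x; simp [hGd, hti]
      rw [this, Set.inter_empty, measureReal_empty]
      exact Real.exp_nonneg _
    rcases hw t ht with h | ⟨B, hB, hBR⟩ | hc
    · exact absurd h hti
    · have hsub : GoodUntil Good w t ∩ {x | ¬ Good t (succeededBefore w x t)} ⊆
          ⋃ v ∈ B, {x | v ∈ succeededBefore w x t} := by
        rintro x ⟨-, hx⟩
        by_contra hno
        simp only [Set.mem_iUnion, not_exists] at hno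
        refine hx (Or.inl (hBR.trans ?_))
        have h1 : (B.card : ℝ) * bitProb D i₀ = ∑ v ∈ B, attemptProb D w t v := by
          rw [← nsmul_eq_mul]
          symm
          refine Finset.sum_eq_card_nsmul fun v hv => ?_
          have := hB v hv
          simp only [attemptProb]
          rw [if_pos (by omega), show t - w v - 1 = i₀ by omega]
        rw [h1]
        unfold contention
        refine Finset.sum_le_sum_of_subset_of_nonneg (fun v hv => ?_)
          fun v _ _ => attemptProb_nonneg _ _ _ _
        simpa using hno v hv
      refine (measureReal_mono hsub (measure_ne_top _ _)).trans ((measureReal_biUnion_finset_le _ _).trans ?_)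
      rw [Finset.sum_eq_zero fun v hv =>
        measureReal_succeeded_by_first_attempt hi₀ v (hB v hv).ge]
      exact Real.exp_nonneg _
    · set c := ∑ v, delayed g (w v) t with hcdef
      -- Now the weight of S is the exponential of θ times the g-total of S. A bad state leaves
      -- contention below R out of c ≥ 2R, so at least c/2 has departed.
      set a : Fin n → ℝ := fun v => Real.exp (θ * delayed g (w v) t) - 1 with hadef
      have hx0 : ∀ v, 0 ≤ θ * delayed g (w v) t := fun v => mul_nonneg hθ (delayed_nonneg hg _ _)
      have hx1 : ∀ v, θ * delayed g (w v) t ≤ 1 := fun v => by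
        simp only [delayed]; split_ifs
        · exact hgθ _
        · simp
      have ha : ∀ v, 0 ≤ a v := fun v => by
        have := Real.add_one_le_exp (θ * delayed g (w v) t)
        simp only [hadef]; linarith [hx0 v]
      have ha2 : ∀ v, a v ≤ 2 * (θ * delayed g (w v) t) := fun v => by
        have h := Real.abs_exp_sub_one_le (x := θ * delayed g (w v) t)
          (by rw [abs_of_nonneg (hx0 v)]; exact hx1 v)
        rw [abs_of_nonneg (hx0 v)] at h
        exact (le_abs_self _).trans h
      have hP : ∀ S, ¬ Good t S → Real.exp (θ * (c / 2)) ≤ stateWeight a S := by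
        intro S hS
        simp only [hGd, not_or, not_le] at hS
        have e : stateWeight a S = Real.exp (θ * ∑ v with v ∈ S, delayed g (w v) t) := by
          rw [Finset.mul_sum, Real.exp_sum, Finset.prod_filter]
          exact Finset.prod_congr rfl fun v _ => by simp [hadef]
        rw [e, Real.exp_le_exp]
        refine mul_le_mul_of_nonneg_left ?_ hθ
        have h1 : ∑ v with v ∉ S, delayed g (w v) t ≤ contention D w t S := by
          unfold contention
          refine Finset.sum_le_sum fun v _ => ?_
          simp only [delayed, attemptProb]; split_ifs
          · exact hgp _
          · exact le_rfl
        have h2 := Finset.sum_filter_add_sum_filter_not Finset.univ (fun v => v ∈ S)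
          fun v => delayed g (w v) t
        linarith [hS.1]
      have h1 := measureReal_state_le (D := D) (Good := Good) (w := w) (t := t) ha
        (P := fun S => ¬ Good t S) hP
      have h2 := expectedWeight_le hD ha hε0 hGood t
      -- Uses a ≤ 2θg and εs ≤ 1/16. Against the threshold θc/2 this leaves the exponent -3θc/8,
      -- which is at most -θR/2.
      have h3 : ε * ∑ v, a v * ∑ s ∈ Finset.range t, attemptProb D w s v ≤ θ * c / 8 := by
        have : ∑ v, a v * ∑ s ∈ Finset.range t, attemptProb D w s v ≤ 2 * (θ * c) * s := by
          have e : 2 * (θ * c) * s = ∑ v, 2 * (θ * delayed g (w v) t) * s := by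
            rw [← Finset.sum_mul, ← Finset.mul_sum, ← Finset.mul_sum]
          rw [e]
          exact Finset.sum_le_sum fun v _ => mul_le_mul (ha2 v) (hsum t ht.le v)
            (Finset.sum_nonneg fun s _ => attemptProb_nonneg _ _ _ _)
            (by linarith [hx0 v])
        have hc0 : 0 ≤ θ * c := mul_nonneg hθ (by linarith)
        calc _ ≤ ε * (2 * (θ * c) * s) := mul_le_mul_of_nonneg_left this hε0
          _ = 2 * (θ * c) * (ε * s) := by ring
          _ ≤ 2 * (θ * c) * (1 / 16) := mul_le_mul_of_nonneg_left hs (by linarith)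
          _ = _ := by ring
      have h4 := h1.trans (h2.trans (Real.exp_le_exp.2 h3))
      have h5 : μ.real (GoodUntil Good w t ∩ {x | ¬ Good t (succeededBefore w x t)})
          ≤ Real.exp (θ * c / 8) / Real.exp (θ * (c / 2)) := by
        rw [le_div_iff₀ (Real.exp_pos _), mul_comm]; exact h4
      refine h5.trans ?_
      rw [← Real.exp_sub, Real.exp_le_exp]
      have := mul_le_mul_of_nonneg_left hc hθ
      have := mul_nonneg hθ hR
      linarith
  have hcompl : μ.real (GoodUntil Good w T)ᶜ ≤ 1 / 4 := by
    refine (measureReal_mono (goodUntil_compl_subset Good w T)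
      (measure_ne_top _ _)).trans
      ((measureReal_biUnion_finset_le _ _).trans ?_)
    refine (Finset.sum_le_card_nsmul _ _ _ fun t ht => hbad t (Finset.mem_range.1 ht)).trans ?_
    rwa [Finset.card_range, nsmul_eq_mul]
  have hu : μ.real (GoodUntil Good w T ∩ {x | u ∈ succeededBefore w x T}) ≤ 1 / 4 := by
    -- Weight 16 on u alone: the exponent 15εs is below 1, so the probability is at most e/16 < 1/4.
    set a : Fin n → ℝ := fun v => if v = u then 15 else 0 with hadef
    have ha : ∀ v, 0 ≤ a v := fun v => by simp only [hadef]; split_ifs <;> norm_num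
    have h1 := measureReal_state_le (D := D) (Good := Good) (w := w) (t := T) ha
      (P := fun S => u ∈ S) (M := 16) (fun S hS => by
        unfold stateWeight
        rw [← Finset.mul_prod_erase _ _ (Finset.mem_univ u), Finset.prod_eq_one]
        · simp [hS, hadef]; norm_num
        · intro v hv
          simp [hadef, Finset.ne_of_mem_erase hv])
    have h2 := expectedWeight_le hD ha hε0 hGood T
    have h3 : ε * ∑ v, a v * ∑ s ∈ Finset.range T, attemptProb D w s v ≤ 1 := by
      simp only [hadef, ite_mul, zero_mul, Finset.sum_ite_eq', Finset.mem_univ, if_true]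
      have := mul_le_mul_of_nonneg_left (hsum T le_rfl u) hε0
      linarith
    have h4 := h1.trans (h2.trans (Real.exp_le_exp.2 h3))
    have := Real.exp_one_lt_d9
    change 16 * μ.real (GoodUntil Good w T ∩ {x | u ∈ succeededBefore w x T}) ≤ _ at h4
    linarith
  have hsub : {x : Fin n → ℕ → Bool | u ∈ succeededBefore w x T} ⊆
      (GoodUntil Good w T)ᶜ ∪ (GoodUntil Good w T ∩ {x | u ∈ succeededBefore w x T}) := by
    intro x hx
    by_cases h : x ∈ GoodUntil Good w T
    · exact Or.inr ⟨h, hx⟩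
    · exact Or.inl h
  have := (measureReal_mono (μ := μ) hsub (measure_ne_top _ _)).trans (measureReal_union_le _ _)
  linarith

/-! ### Random wake-up times and the flooding schedule -/

/-- There are `m` wake-up times in `[0, T)` for which the contention of the parties is spread
evenly over all times after `t₀`. -/
lemma exists_spread_wakeups {g : ℕ → ℝ} {θ R : ℝ} {m T t₀ : ℕ} (hg : ∀ i, 0 ≤ g i)
    (hθ : 0 ≤ θ) (hgθ : ∀ i, θ * g i ≤ 1)
    (hm : 6 * R * T ≤ m * ∑ i ∈ Finset.range t₀, g i)
    (hT : T * Real.exp (-(θ * R)) < 1) (hTpos : 0 < T) :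
    ∃ τ : Fin m → Fin T, ∀ t < T, t₀ ≤ t → 2 * R ≤ ∑ j, delayed g (τ j) t := by
  classical
  by_contra! hcon
  set σ := ∑ i ∈ Finset.range t₀, g i with hσ
  have hT0 : (0 : ℝ) < T := by exact_mod_cast hTpos
  have hone : ∀ t < T, t₀ ≤ t →
      ∑ τ : Fin T, Real.exp (-(θ * delayed g τ t)) ≤ T * Real.exp (-(θ * σ / (2 * T))) := by
    intro t ht ht0
    -- For y in [0, 1], e^(-y) ≤ 1/(1+y) ≤ 1 - y/2; this is where θg ≤ 1 enters.
    have h1 : ∀ τ : Fin T, Real.exp (-(θ * delayed g τ t)) ≤ 1 - θ * delayed g τ t / 2 := by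
      intro τ
      have hx0 : 0 ≤ θ * delayed g τ t := mul_nonneg hθ (delayed_nonneg hg _ _)
      have hx1 : θ * delayed g τ t ≤ 1 := by
        simp only [delayed]; split_ifs
        · exact hgθ _
        · simp
      set y := θ * delayed g τ t
      have := Real.add_one_le_exp y
      have he : Real.exp (-y) ≤ 1 / (1 + y) := by
        rw [Real.exp_neg, ← one_div]
        exact one_div_le_one_div_of_le (by linarith) (by linarith)
      refine he.trans ?_
      rw [div_le_iff₀ (by linarith)]
      nlinarith
    -- The wake-up times from t - t₀ to t - 1 meet each index below t₀ exactly once.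
    have h2 : σ ≤ ∑ τ : Fin T, delayed g τ t := by
      rw [Fin.sum_univ_eq_sum_range (fun τ => delayed g τ t) T]
      have h3 : ∑ τ ∈ Finset.Ico (t - t₀) t, delayed g τ t = σ := by
        rw [hσ]
        refine Finset.sum_bij' (fun τ _ => t - τ - 1) (fun i _ => t - i - 1) ?_ ?_ ?_ ?_ ?_
        · intro τ h; simp only [Finset.mem_Ico, Finset.mem_range] at *; omega
        · intro τ h; simp only [Finset.mem_Ico, Finset.mem_range] at *; omega
        · intro τ h; simp only [Finset.mem_Ico] at *; omega
        · intro τ h; simp only [Finset.mem_range] at *; omega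
        · intro τ h; simp only [Finset.mem_Ico] at h; simp only [delayed]; rw [if_pos h.2]
      rw [← h3]
      refine Finset.sum_le_sum_of_subset_of_nonneg (fun τ h => ?_)
        fun τ _ _ => delayed_nonneg hg _ _
      simp only [Finset.mem_Ico, Finset.mem_range] at *; omega
    calc ∑ τ : Fin T, Real.exp (-(θ * delayed g τ t))
        ≤ ∑ τ : Fin T, (1 - θ * delayed g τ t / 2) := Finset.sum_le_sum fun τ _ => h1 τ
      _ = T - θ * (∑ τ : Fin T, delayed g τ t) / 2 := by
          rw [Finset.sum_sub_distrib, ← Finset.sum_div, ← Finset.mul_sum]; simp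
      _ ≤ T - θ * σ / 2 := by
          have := mul_le_mul_of_nonneg_left h2 hθ; linarith
      _ = T * (-(θ * σ / (2 * T)) + 1) := by field_simp; ring
      _ ≤ _ := mul_le_mul_of_nonneg_left (Real.add_one_le_exp _) hT0.le
  -- The probabilistic method by counting: each of the T^m choices is assumed to fail at some time,
  -- where its exponent is nonnegative.
  have hkey : (T : ℝ) ^ m ≤ ∑ t ∈ Finset.Ico t₀ T, ∑ τ : Fin m → Fin T,
      Real.exp (2 * (θ * R) - θ * ∑ j, delayed g (τ j) t) := by
    rw [Finset.sum_comm]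
    calc (T : ℝ) ^ m = ∑ _τ : Fin m → Fin T, (1 : ℝ) := by simp
      _ ≤ _ := Finset.sum_le_sum fun τ _ => by
        obtain ⟨t, h1, h2, h3⟩ := hcon τ
        refine le_trans ?_ (Finset.single_le_sum (fun t _ => Real.exp_nonneg _)
          (Finset.mem_Ico.2 ⟨h2, h1⟩))
        rw [Real.one_le_exp_iff]
        have := mul_le_mul_of_nonneg_left h3.le hθ
        linarith
  have hterm : ∀ t ∈ Finset.Ico t₀ T, ∑ τ : Fin m → Fin T,
      Real.exp (2 * (θ * R) - θ * ∑ j, delayed g (τ j) t) ≤ T ^ m * Real.exp (-(θ * R)) := by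
    intro t ht
    rw [Finset.mem_Ico] at ht
    have e : ∑ τ : Fin m → Fin T, Real.exp (2 * (θ * R) - θ * ∑ j, delayed g (τ j) t)
        = Real.exp (2 * (θ * R)) * (∑ τ : Fin T, Real.exp (-(θ * delayed g τ t))) ^ m := by
      rw [← Fin.prod_const, Finset.prod_univ_sum, Finset.mul_sum, Fintype.piFinset_univ]
      refine Finset.sum_congr rfl fun τ _ => ?_
      rw [← Real.exp_sum, ← Real.exp_add, Finset.mul_sum, Finset.sum_neg_distrib]
      rfl
    rw [e]
    calc _ ≤ Real.exp (2 * (θ * R)) * (T * Real.exp (-(θ * σ / (2 * T)))) ^ m :=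
          mul_le_mul_of_nonneg_left (pow_le_pow_left₀
            (Finset.sum_nonneg fun _ _ => Real.exp_nonneg _) (hone t ht.2 ht.1) m)
            (Real.exp_nonneg _)
      _ = T ^ m * Real.exp (2 * (θ * R) - m * (θ * σ / (2 * T))) := by
          rw [mul_pow, ← Real.exp_nat_mul, Real.exp_sub, mul_neg, Real.exp_neg]; ring
      _ ≤ _ := by
          refine mul_le_mul_of_nonneg_left (Real.exp_le_exp.2 ?_) (by positivity)
          -- Mean contention 6R against the target 2R leaves the exponent -θR for the union bound
          -- over times.
          have : 3 * (θ * R) ≤ m * (θ * σ / (2 * T)) := by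
            rw [mul_div_assoc', le_div_iff₀ (by positivity)]
            have := mul_le_mul_of_nonneg_left hm hθ
            linarith
          linarith
  have hfin := hkey.trans (Finset.sum_le_card_nsmul _ _ _ hterm)
  rw [Nat.card_Ico, nsmul_eq_mul] at hfin
  have h1 : ((T - t₀ : ℕ) : ℝ) * (T ^ m * Real.exp (-(θ * R))) ≤
      T ^ m * (T * Real.exp (-(θ * R))) := by
    have : ((T - t₀ : ℕ) : ℝ) ≤ T := by exact_mod_cast Nat.sub_le _ _
    calc _ ≤ (T : ℝ) * (T ^ m * Real.exp (-(θ * R))) :=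
          mul_le_mul_of_nonneg_right this (by positivity)
      _ = _ := by ring
  have h2 : (0 : ℝ) < T ^ m := by positivity
  have h3 : (T : ℝ) ^ m * (T * Real.exp (-(θ * R))) < T ^ m * 1 :=
    mul_lt_mul_of_pos_left hT h2
  linarith

lemma le_latency_of_notMem {n : ℕ} {w : Schedule n} {x : Fin n → ℕ → Bool} {u : Fin n} {T : ℕ}
    (h : u ∉ succeededBefore w x (w u + T)) : (T : ℕ∞) ≤ latency w x u := by
  refine le_iInf₂ fun l hl => ?_
  rw [Nat.cast_le]
  by_contra! hlt
  exact h (succeededBefore_mono w x (show w u + l + 1 ≤ w u + T by omega) (Or.inr hl))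

lemma le_expLatency {D : LocalClockProtocol} {n : ℕ} {w : Schedule n} {u : Fin n} {T : ℕ}
    (hP : (execution D n).real {x | u ∈ succeededBefore w x (w u + T)} ≤ 1 / 2) :
    ENNReal.ofReal (T / 2) ≤ expLatency D n := by
  have hm : MeasurableSet {x : Fin n → ℕ → Bool | u ∈ succeededBefore w x (w u + T)} :=
    bitAlgebra_le _ _ (measurableSet_state w _ fun S => u ∈ S)
  have h1 : 1 / 2 ≤ (execution D n).real {x | u ∈ succeededBefore w x (w u + T)}ᶜ := by
    rw [probReal_compl_eq_one_sub hm]; linarith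
  refine le_trans ?_ (le_iSup₂ (f := fun (w : Schedule n) (u : Fin n) =>
    ∫⁻ x, ((latency w x u : ℕ∞) : ℝ≥0∞) ∂(execution D n)) w u)
  calc ENNReal.ofReal (T / 2) = (T : ℝ≥0∞) * ENNReal.ofReal (1 / 2) := by
        rw [← ENNReal.ofReal_natCast, ← ENNReal.ofReal_mul (by positivity)]; congr 1; ring
    _ ≤ (T : ℝ≥0∞) * execution D n {x | u ∈ succeededBefore w x (w u + T)}ᶜ := by
        gcongr
        rw [← ENNReal.ofReal_toReal (measure_ne_top (execution D n) _)]
        exact ENNReal.ofReal_le_ofReal h1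
    _ = ∫⁻ x in {x | u ∈ succeededBefore w x (w u + T)}ᶜ, (T : ℝ≥0∞) ∂(execution D n) := by
        rw [setLIntegral_const]
    _ ≤ ∫⁻ x in {x | u ∈ succeededBefore w x (w u + T)}ᶜ,
          ((latency w x u : ℕ∞) : ℝ≥0∞) ∂(execution D n) := by
        refine setLIntegral_mono' hm.compl fun x hx => ?_
        have := le_latency_of_notMem hx
        calc (T : ℝ≥0∞) = ((T : ℕ∞) : ℝ≥0∞) := by simp
          _ ≤ _ := by exact_mod_cast this
    _ ≤ _ := setLIntegral_le_lintegral _ _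

/-- A lower bound on the expected latency of `n` parties: `k` parties with a fresh first attempt
keep the resource busy at each of the first `t₀` times, and `m` parties woken up over the period
`[0, T)` do so afterwards. -/
lemma half_le_expLatency {D : LocalClockProtocol} (hD : D.IsMemoryless) {n m k t₀ i₀ T : ℕ}
    {θ R : ℝ} {g : ℕ → ℝ} (hi₀ : ∀ i < i₀, bitProb D i = 0)
    (hg : ∀ i, 0 ≤ g i) (hgp : ∀ i, g i ≤ bitProb D i) (hθ : 1 ≤ θ) (hgθ : ∀ i, θ * g i ≤ 1)
    (hR : 0 ≤ R) (hk : R ≤ k * bitProb D i₀) (hn : 1 + t₀ * k + m ≤ n)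
    (hm : 6 * R * T ≤ m * ∑ i ∈ Finset.range t₀, g i)
    (hs : Real.exp (1 - R) * ∑ i ∈ Finset.range T, bitProb D i ≤ 1 / 16)
    (hT : T * Real.exp (-(θ * R / 2)) ≤ 1 / 4) (hTpos : 0 < T) :
    ENNReal.ofReal (T / 2) ≤ expLatency D n := by
  classical
  have hθ0 : 0 ≤ θ := by linarith
  have hθR : 0 ≤ θ * R := mul_nonneg hθ0 hR
  obtain ⟨τ, hτ⟩ := exists_spread_wakeups (m := m) (t₀ := t₀) hg hθ0 hgθ hm (by
    have : (T : ℝ) * Real.exp (-(θ * R)) ≤ T * Real.exp (-(θ * R / 2)) :=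
      mul_le_mul_of_nonneg_left (Real.exp_le_exp.2 (by linarith)) (by positivity)
    linarith) hTpos
  obtain ⟨f⟩ : Nonempty (Unit ⊕ (Fin t₀ × Fin k) ⊕ Fin m ↪ Fin n) :=
    Function.Embedding.nonempty_of_card_le (by simp; omega)
  set w₀ : Unit ⊕ (Fin t₀ × Fin k) ⊕ Fin m → ℕ :=
    Sum.elim (fun _ => 0) (Sum.elim (fun a => a.1) fun j => τ j) with hw₀
  -- Surplus parties wake at 0; they can only add contention.
  set w : Schedule n := Function.extend f w₀ fun _ => 0 with hwdef
  have hwf : ∀ a, w (f a) = w₀ a := fun a => f.injective.extend_apply _ _ _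
  have hwu : w (f (Sum.inl ())) = 0 := hwf _
  refine le_expLatency (w := w) (u := f (Sum.inl ())) ?_
  rw [hwu, zero_add]
  refine success_prob_le hD hi₀ hg hgp hθ0 hgθ hR (fun t ht => ?_) hs hT _
  by_cases h1 : t ≤ i₀
  · exact Or.inl h1
  right
  -- The fresh parties woken at j first attempt at j + i₀ + 1, so they cover the times up to i₀ +
  -- t₀.
  by_cases h2 : t < i₀ + 1 + t₀
  · left
    refine ⟨Finset.univ.image fun a : Fin k => f (Sum.inr (Sum.inl (⟨t - i₀ - 1, by omega⟩, a))),
      ?_, ?_⟩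
    · intro v hv
      obtain ⟨a, -, rfl⟩ := Finset.mem_image.1 hv
      rw [hwf]
      simp only [hw₀, Sum.elim_inr, Sum.elim_inl]
      omega
    · rwa [Finset.card_image_of_injective _ fun a b h => by simpa using h, Finset.card_univ,
        Fintype.card_fin]
  · right
    refine (hτ t ht (by omega)).trans ?_
    calc ∑ j, delayed g (τ j) t = ∑ j, delayed g (w (f (Sum.inr (Sum.inr j)))) t :=
          Finset.sum_congr rfl fun j _ => by rw [hwf]; rfl
      _ = ∑ v ∈ Finset.univ.image fun j : Fin m => f (Sum.inr (Sum.inr j)),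
            delayed g (w v) t := by
          rw [Finset.sum_image fun a _ b _ h => by simpa using h]
      _ ≤ _ := Finset.sum_le_sum_of_subset_of_nonneg (Finset.subset_univ _)
          fun v _ _ => delayed_nonneg hg _ _


/-! ### Blocking chosen local times -/

lemma execution_all_false {D : LocalClockProtocol} (hD : D.IsMemoryless) {n : ℕ}
    (F : Finset (Fin n × ℕ)) :
    (execution D n).real {x | ∀ b ∈ F, x b.1 b.2 = false} = ∏ b ∈ F, (1 - bitProb D b.2) := by
  simpa using execution_cylinder hD F fun _ => false

/-- A party remains in the system with a probability that is not much smaller than that of making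
no attempt at its local times outside of `W`, if the attempts at the local times in `W` are blocked
by `k` parties each. -/
lemma exists_blocking_schedule {D : LocalClockProtocol} (hD : D.IsMemoryless) {n k i₀ : ℕ}
    (hi₀ : ∀ i < i₀, bitProb D i = 0) (L : ℕ) (W : Finset ℕ) (hn : 1 + W.card * k ≤ n) :
    ∃ (w : Schedule n) (u : Fin n),
      (∏ i ∈ Finset.range L \ W, (1 - bitProb D i)) * (1 - W.card * (1 - bitProb D i₀) ^ k)
        ≤ (execution D n).real {x | u ∉ succeededBefore w x (w u + (L + 1))} := by
  classical
  obtain ⟨f⟩ : Nonempty (Unit ⊕ (W × Fin k) ↪ Fin n) :=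
    Function.Embedding.nonempty_of_card_le (by simpa using hn)
  set μ := execution D n
  -- Delaying u by i₀ aligns the clocks: a blocker woken at i reads its bit i₀ exactly when u reads
  -- its bit i.
  set w : Schedule n := Function.extend f (Sum.elim (fun _ => i₀) fun a => (a.1 : ℕ))
    fun _ => 0 with hwdef
  have hwf : ∀ a, w (f a) = _ := fun a => f.injective.extend_apply _ _ _
  set u := f (Sum.inl ()) with hu
  have hwu : w u = i₀ := hwf _
  have hwb : ∀ (i : W) (a : Fin k), w (f (Sum.inr (i, a))) = i := fun i a => hwf _
  refine ⟨w, u, ?_⟩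
  set FA : Finset (Fin n × ℕ) := (Finset.range L \ W).image fun i => (u, i) with hFA
  set FC : W → Finset (Fin n × ℕ) := fun i =>
    (Finset.univ : Finset (Fin k)).image fun a => (f (Sum.inr (i, a)), i₀) with hFC
  set Z : Finset (Fin n × ℕ) → Set (Fin n → ℕ → Bool) := fun F =>
    {x | ∀ b ∈ F, x b.1 b.2 = false} with hZ
  set E : Fin n → Set (Fin n → ℕ → Bool) := fun v =>
    {x | v ∈ succeededBefore w x (w v + i₀ + 1)} with hE
  -- If u is silent outside W yet succeeds, it does so at some i in W, where its blockers were all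
  -- silent or one had left early, a null event. Keeping `FA` in the silent event lets the product
  -- factor out.
  have hsub : Z FA ⊆ {x | u ∉ succeededBefore w x (w u + (L + 1))} ∪
      ((⋃ i ∈ (Finset.univ : Finset W), Z (FA ∪ FC i)) ∪
        ⋃ v ∈ (Finset.univ : Finset (Fin n)), E v) := by
    intro x hx
    by_contra hcon
    simp only [Set.mem_union, not_or, Set.mem_iUnion, not_exists, Set.mem_ofPred_eq, not_not, hE]
      at hcon
    obtain ⟨hsucc, hC, hEv⟩ := hcon
    have hex : ∃ l ≤ L, SucceedsAt w x (w u + l) u := by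
      by_contra! hno
      have hind : ∀ t ≤ w u + (L + 1), u ∉ succeededBefore w x t := by
        intro t
        induction t with
        | zero => intro _; exact Set.notMem_empty u
        | succ t ih =>
          rintro ht (h | h)
          · exact ih (by omega) h
          · obtain ⟨i, hi, -⟩ := h.2.1
            refine hno (i + 1) (by omega) ?_
            rw [← hi]; exact h
      exact hind _ le_rfl hsucc
    obtain ⟨l, hl, hS⟩ := hex
    obtain ⟨i, hi, hxi⟩ := hS.2.1
    obtain rfl : l = i + 1 := by omega
    have hiW : i ∈ W := by
      by_contra hiW
      have := hx (u, i) (Finset.mem_image.2 ⟨i, by simp; exact ⟨by omega, hiW⟩, rfl⟩)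
      simp [hxi] at this
    have hCi := hC ⟨i, hiW⟩ (Finset.mem_univ _)
    simp only [hZ, Set.mem_ofPred_eq, not_forall, Finset.mem_union] at hCi
    obtain ⟨b, hb, hbx⟩ := hCi
    rcases hb with hb | hb
    · exact hbx (hx b hb)
    obtain ⟨a, -, rfl⟩ := Finset.mem_image.1 hb
    have hw : w (f (Sum.inr ((⟨i, hiW⟩ : W), a))) = i := hwb ⟨i, hiW⟩ a
    set v := f (Sum.inr ((⟨i, hiW⟩ : W), a)) with hv
    have hvS : v ∉ succeededBefore w x (w u + (i + 1)) := by
      have := hEv v (Finset.mem_univ _)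
      rwa [hw, show i + i₀ + 1 = w u + (i + 1) by omega] at this
    have := hS.2.2 v hvS ⟨i₀, by omega, by simpa using hbx⟩
    rw [hv, hu] at this
    simpa using f.injective this
  have hA : μ.real (Z FA) = ∏ i ∈ Finset.range L \ W, (1 - bitProb D i) := by
    rw [hZ, execution_all_false hD, Finset.prod_image fun a _ b _ h => (Prod.ext_iff.1 h).2]
  have hAC : ∀ i, μ.real (Z (FA ∪ FC i)) =
      (∏ i ∈ Finset.range L \ W, (1 - bitProb D i)) * (1 - bitProb D i₀) ^ k := by
    intro i
    have hdisj : Disjoint FA (FC i) := by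
      rw [Finset.disjoint_left]
      intro b hb hb'
      obtain ⟨j, -, rfl⟩ := Finset.mem_image.1 hb
      obtain ⟨a, -, h⟩ := Finset.mem_image.1 hb'
      have := f.injective (Prod.ext_iff.1 h).1
      simp at this
    rw [← hA, hZ]
    simp only []
    rw [execution_all_false hD, execution_all_false hD, Finset.prod_union hdisj]
    congr 1
    rw [Finset.prod_image fun a _ b _ h => by simpa using (Prod.ext_iff.1 h).1]
    simp
  have hE0 : ∀ v, μ.real (E v) = 0 := fun v =>
    measureReal_succeeded_by_first_attempt hi₀ v le_rfl
  have h1 := (measureReal_mono (μ := μ) hsub (measure_ne_top _ _)).trans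
    (measureReal_union_le _ _)
  have h2 := measureReal_union_le (μ := μ) (⋃ i ∈ (Finset.univ : Finset W), Z (FA ∪ FC i))
    (⋃ v ∈ (Finset.univ : Finset (Fin n)), E v)
  have h3 := measureReal_biUnion_finset_le (μ := μ) (Finset.univ : Finset W)
    fun i => Z (FA ∪ FC i)
  have h4 := measureReal_biUnion_finset_le (μ := μ) (Finset.univ : Finset (Fin n)) E
  simp only [hE0, Finset.sum_const_zero] at h4
  simp only [hAC, Finset.sum_const, Finset.card_univ, Fintype.card_coe, nsmul_eq_mul] at h3
  rw [hA] at h1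
  linarith

lemma latency_le_imp_mem {n : ℕ} {w : Schedule n} {x : Fin n → ℕ → Bool} {u : Fin n} {L : ℕ}
    (h : latency w x u ≤ L) : u ∈ succeededBefore w x (w u + (L + 1)) := by
  by_contra hno
  have := (le_latency_of_notMem hno).trans h
  rw [Nat.cast_le] at this
  omega

lemma prob_le_of_whpLatency_le {D : LocalClockProtocol} {n L : ℕ} (h : whpLatency D n ≤ L)
    (w : Schedule n) (u : Fin n) :
    (execution D n).real {x | u ∉ succeededBefore w x (w u + (L + 1))} ≤ ((n : ℝ) ^ 2)⁻¹ := by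
  have hmem : whpLatency D n ∈ {L : ℕ∞ | ∀ (w : Schedule n) (u : Fin n),
      1 - ((n : ℝ) ^ 2)⁻¹ ≤ (execution D n).real {x | latency w x u ≤ L}} := by
    -- The infimum in ℕ∞ is attained, since ⊤ is admissible.
    refine csInf_mem ⟨⊤, fun w u => ?_⟩
    simp only [le_top]
    have : (execution D n).real {_x | True} = 1 := by simp
    rw [this]
    have : 0 ≤ ((n : ℝ) ^ 2)⁻¹ := by positivity
    linarith
  have h1 := hmem w u
  have h2 : (execution D n).real {x | latency w x u ≤ whpLatency D n} ≤
      (execution D n).real {x | u ∈ succeededBefore w x (w u + (L + 1))} :=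
    measureReal_mono (fun x hx => latency_le_imp_mem (le_trans hx h)) (measure_ne_top _ _)
  have hm : MeasurableSet {x : Fin n → ℕ → Bool | u ∈ succeededBefore w x (w u + (L + 1))} :=
    bitAlgebra_le _ _ (measurableSet_state w _ fun S => u ∈ S)
  have h3 := probReal_compl_eq_one_sub (μ := execution D n) hm
  have h4 : {x : Fin n → ℕ → Bool | u ∉ succeededBefore w x (w u + (L + 1))}
      = {x | u ∈ succeededBefore w x (w u + (L + 1))}ᶜ := by ext x; simp
  rw [h4, h3]
  linarith

lemma prod_one_sub_le {D : LocalClockProtocol} (hD : D.IsMemoryless) {n k i₀ L : ℕ}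
    (hi₀ : ∀ i < i₀, bitProb D i = 0) (W : Finset ℕ) (hn : 1 + W.card * k ≤ n)
    (hL : whpLatency D n ≤ L) :
    (∏ i ∈ Finset.range L \ W, (1 - bitProb D i)) * (1 - W.card * (1 - bitProb D i₀) ^ k)
        ≤ ((n : ℝ) ^ 2)⁻¹ := by
  obtain ⟨w, u, h⟩ := exists_blocking_schedule hD hi₀ L W hn
  exact h.trans (prob_le_of_whpLatency_le hL w u)

/-- With a small latency with high probability, a party attempts logarithmically often by
unlikely attempts. -/
lemma log_sub_one_le_sum {D : LocalClockProtocol} (hD : D.IsMemoryless) {n k i₀ L : ℕ}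
    (hi₀ : ∀ i < i₀, bitProb D i = 0) (W : Finset ℕ) (hn : 1 + W.card * k ≤ n)
    (hL : whpLatency D n ≤ L) (hW : ∀ i, i ∉ W → i < L → bitProb D i ≤ 1 / 2)
    (hk : W.card * (1 - bitProb D i₀) ^ k ≤ 1 / 2) :
    Real.log n - 1 ≤ ∑ i ∈ Finset.range L \ W, bitProb D i := by
  have h := prod_one_sub_le hD hi₀ W hn hL
  set S := ∑ i ∈ Finset.range L \ W, bitProb D i
  have hnpos : (0 : ℝ) < n := by exact_mod_cast (by omega : 0 < n)
  -- Uses 1 - p ≥ e^(-2p) for p ≤ 1/2; the 2 matches the exponent of n⁻².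
  have hprod : Real.exp (-(2 * S)) ≤ ∏ i ∈ Finset.range L \ W, (1 - bitProb D i) := by
    rw [Finset.mul_sum, ← Finset.sum_neg_distrib, Real.exp_sum]
    refine Finset.prod_le_prod (fun _ _ => Real.exp_nonneg _) fun i hi => ?_
    rw [Finset.mem_sdiff, Finset.mem_range] at hi
    have h0 := bitProb_nonneg D i
    have h1 := hW i hi.2 hi.1
    have h2 := Real.add_one_le_exp (2 * bitProb D i)
    rw [Real.exp_neg, inv_le_comm₀ (Real.exp_pos _) (by linarith)]
    refine le_trans ?_ h2
    rw [inv_le_iff_one_le_mul₀ (by linarith)]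
    nlinarith
  have h1 : Real.exp (-(2 * S)) * (1 / 2) ≤ ((n : ℝ) ^ 2)⁻¹ :=
    (mul_le_mul hprod (by linarith) (by norm_num)
      ((Real.exp_nonneg _).trans hprod)).trans h
  have h2 : Real.exp (-(2 * S) + 2 * Real.log n) ≤ Real.exp 2 := by
    rw [Real.exp_add, mul_comm 2 (Real.log n), Real.exp_mul, Real.exp_log hnpos]
    norm_cast
    have h3 : Real.exp (-(2 * S)) * (n : ℝ) ^ 2 ≤ 2 := by
      rw [le_inv_comm₀ (by positivity) (by positivity)] at h1
      rw [← le_div_iff₀' (Real.exp_pos _)]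
      refine h1.trans (le_of_eq ?_)
      field_simp
    have h4 := Real.add_one_le_exp (2 : ℝ)
    push_cast
    linarith
  rw [Real.exp_le_exp] at h2
  linarith


/-! ### Asymptotics along n = q⁴ -/

/-- The logarithm of `q`, rounded up. -/
def ceilLog (q : ℕ) : ℕ := ⌈Real.log q⌉₊

lemma log_le_ceilLog (q : ℕ) : Real.log q ≤ ceilLog q := Nat.le_ceil _

lemma ceilLog_le_log_add_one (q : ℕ) : (ceilLog q : ℝ) ≤ Real.log q + 1 :=
  (Nat.ceil_lt_add_one (Real.log_natCast_nonneg q)).le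

lemma le_exp_ceilLog {q : ℕ} (hq : 0 < q) : (q : ℝ) ≤ Real.exp (ceilLog q) := by
  rw [← Real.log_le_iff_le_exp (by exact_mod_cast hq)]; exact log_le_ceilLog q

lemma exp_ceilLog_sub_one_le {q : ℕ} (hq : 0 < q) : Real.exp (ceilLog q - 1) ≤ (q : ℝ) := by
  rw [← Real.le_log_iff_exp_le (by exact_mod_cast hq)]; linarith [ceilLog_le_log_add_one q]

lemma tendsto_ceilLog : Tendsto ceilLog atTop atTop :=
  tendsto_nat_ceil_atTop.comp (Real.tendsto_log_atTop.comp tendsto_natCast_atTop_atTop)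

lemma eventually_le_ceilLog (M : ℝ) : ∀ᶠ q : ℕ in atTop, M ≤ ceilLog q :=
  (tendsto_natCast_atTop_atTop.comp tendsto_ceilLog).eventually_ge_atTop M

lemma eventually_ceilLog_pow_le (M : ℝ) (hM : 0 < M) (j : ℕ) :
    ∀ᶠ q : ℕ in atTop, M * (ceilLog q : ℝ) ^ j ≤ q := by
  have h := (Real.tendsto_pow_mul_exp_neg_atTop_nhds_zero j).comp
    (tendsto_natCast_atTop_atTop.comp tendsto_ceilLog)
  have hpos : 0 < Real.exp (-1) / M := by positivity
  filter_upwards [h.eventually_le_const hpos, eventually_gt_atTop 0] with q h1 hq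
  simp only [Function.comp_apply] at h1
  refine le_trans ?_ (exp_ceilLog_sub_one_le hq)
  rw [le_div_iff₀ hM] at h1
  rw [sub_eq_add_neg, Real.exp_add]
  have h2 := mul_le_mul_of_nonneg_left h1 (Real.exp_nonneg (ceilLog q))
  calc M * (ceilLog q : ℝ) ^ j
      = Real.exp (ceilLog q) * ((ceilLog q : ℝ) ^ j * Real.exp (-ceilLog q) * M) := by
        rw [Real.exp_neg]; field_simp
    _ ≤ _ := h2

lemma sum_bitProb_le (D : LocalClockProtocol) (N : ℕ) :
    ∑ i ∈ Finset.range N, bitProb D i ≤ N := by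
  refine (Finset.sum_le_card_nsmul _ _ 1 fun i _ => bitProb_le_one D i).trans ?_
  simp

lemma sum_bitProb_mono (D : LocalClockProtocol) {M N : ℕ} (h : M ≤ N) :
    ∑ i ∈ Finset.range M, bitProb D i ≤ ∑ i ∈ Finset.range N, bitProb D i :=
  Finset.sum_le_sum_of_subset_of_nonneg (Finset.range_mono h) fun i _ _ => bitProb_nonneg D i

lemma exists_latency_exponent {D : LocalClockProtocol}
    (h : IsNPolylog fun n => ((whpLatency D n : ℕ∞) : ENNReal)) :
    ∃ c : ℕ, ∀ᶠ n : ℕ in atTop, ∀ L : ℕ, (n : ℝ) * (Real.log n) ^ c ≤ L →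
      whpLatency D n ≤ L := by
  obtain ⟨C, hC⟩ := h
  obtain ⟨c, hc⟩ := exists_nat_ge C
  refine ⟨c, ?_⟩
  have hlog := (Real.tendsto_log_atTop.comp tendsto_natCast_atTop_atTop).eventually_ge_atTop
    (1 : ℝ)
  filter_upwards [hC, hlog] with n h1 h2 L hL
  simp only [Function.comp_apply] at h2
  have h3 : (Real.log n) ^ C ≤ (Real.log n) ^ c := by
    rw [← Real.rpow_natCast]; exact Real.rpow_le_rpow_of_exponent_le h2 hc
  have h4 : ((whpLatency D n : ℕ∞) : ENNReal) ≤ ((L : ℕ∞) : ENNReal) := by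
    refine h1.trans ?_
    rw [ENat.toENNReal_coe, ← ENNReal.ofReal_natCast]
    exact ENNReal.ofReal_le_ofReal
      ((mul_le_mul_of_nonneg_left h3 (Nat.cast_nonneg n)).trans hL)
  exact_mod_cast h4

/-- A protocol that never attempts violates the high-probability bound even with no blockers: the
survival bound is 1, not n⁻². -/
lemma exists_first_attempt {D : LocalClockProtocol} (hD : D.IsMemoryless)
    (h : IsNPolylog fun n => ((whpLatency D n : ℕ∞) : ENNReal)) :
    ∃ i₀, 0 < bitProb D i₀ ∧ ∀ i < i₀, bitProb D i = 0 := by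
  classical
  by_cases hex : ∃ i, 0 < bitProb D i
  · refine ⟨Nat.find hex, Nat.find_spec hex, fun i hi => ?_⟩
    exact le_antisymm (not_lt.1 (Nat.find_min hex hi)) (bitProb_nonneg D i)
  · exfalso
    push Not at hex
    have h0 : ∀ i, bitProb D i = 0 := fun i => le_antisymm (hex i) (bitProb_nonneg D i)
    obtain ⟨c, hc⟩ := exists_latency_exponent h
    obtain ⟨n, h1, h2⟩ := (hc.and (eventually_ge_atTop 2)).exists
    have := prod_one_sub_le hD (n := n) (k := 0) (i₀ := 0) (by simp) ∅ (by simp; omega)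
      (h1 _ (Nat.le_ceil _))
    have h3 : (2 : ℝ) ≤ n := by exact_mod_cast h2
    simp only [h0] at this
    simp at this
    have h4 : ((n : ℝ) ^ 2)⁻¹ < 1 := inv_lt_one_of_one_lt₀ (by nlinarith)
    linarith

/-- The power q⁴ leaves room for the auxiliary parties. Since log n = 4 log q the square costs 16,
and log b ≤ log log n because b ≤ 4 log q. -/
lemma eventually_expLatency_pow_le {D : LocalClockProtocol} (h : IsLittleOTop
      (fun n => expLatency D n)
      (fun n => (n : ℝ) * (Real.log n) ^ 2 / (Real.log (Real.log n)) ^ 2))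
    {ε : ℝ} (hε : 0 < ε) : ∀ᶠ q : ℕ in atTop, expLatency D (q ^ 4) ≤
      ENNReal.ofReal (ε * (16 * ((q : ℝ) ^ 4 * (ceilLog q : ℝ) ^ 2
        / (Real.log (ceilLog q)) ^ 2))) := by
  have ht : Tendsto (fun q : ℕ => q ^ 4) atTop atTop := tendsto_pow_atTop (by norm_num)
  filter_upwards [ht.eventually (h ε hε), eventually_le_ceilLog 3, eventually_gt_atTop 0]
    with q h1 hb hq
  refine h1.trans (ENNReal.ofReal_le_ofReal (mul_le_mul_of_nonneg_left ?_ hε.le))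
  have hl := ceilLog_le_log_add_one q
  have hl' := log_le_ceilLog q
  have e : Real.log ((q ^ 4 : ℕ) : ℝ) = 4 * Real.log q := by
    rw [Nat.cast_pow, Real.log_pow]; norm_num
  have hlogb : 0 < Real.log (ceilLog q) := Real.log_pos (by linarith)
  rw [e, Nat.cast_pow]
  have h2 : Real.log (ceilLog q) ≤ Real.log (4 * Real.log q) :=
    Real.log_le_log (by linarith) (by linarith)
  have h3 : (4 * Real.log q) ^ 2 ≤ 16 * (ceilLog q : ℝ) ^ 2 := by
    have := pow_le_pow_left₀ (by linarith) hl' 2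
    linarith [mul_pow (4 : ℝ) (Real.log q) 2]
  calc (q : ℝ) ^ 4 * (4 * Real.log q) ^ 2 / Real.log (4 * Real.log q) ^ 2
      ≤ (q : ℝ) ^ 4 * (16 * (ceilLog q : ℝ) ^ 2) / Real.log (ceilLog q) ^ 2 := by gcongr
    _ = _ := by ring

/-! ### The total attempt probability is polylogarithmic -/

/-- A protocol with a small expected latency attempts only polylogarithmically often. -/
lemma eventually_sum_bitProb_le {D : LocalClockProtocol} (hD : D.IsMemoryless) {i₀ : ℕ}
    (hp₀ : 0 < bitProb D i₀) (hi₀ : ∀ i < i₀, bitProb D i = 0) (h : IsLittleOTop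
      (fun n => expLatency D n)
      (fun n => (n : ℝ) * (Real.log n) ^ 2 / (Real.log (Real.log n)) ^ 2)) :
    ∀ᶠ q : ℕ in atTop, ∑ i ∈ Finset.range q, bitProb D i ≤ (ceilLog q : ℝ) ^ 4 := by
  filter_upwards [eventually_expLatency_pow_le h (show (0 : ℝ) < 1 / 64 by norm_num),
    eventually_le_ceilLog 240, eventually_le_ceilLog (20 / bitProb D i₀),
    eventually_ceilLog_pow_le 1 one_pos 2, eventually_ge_atTop 2] with q h1 hb hbp hq2 hq
  by_contra! hcon
  set b := ceilLog q with hbdef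
  set p := bitProb D i₀
  have hqR : (2 : ℝ) ≤ q := by exact_mod_cast hq
  have hq0 : 0 < q := by omega
  rw [one_mul] at hq2
  have hqe := le_exp_ceilLog hq0
  rw [← hbdef] at hqe
  have hsize : 2 * (1 + q * b ^ 2) ≤ q ^ 4 := by
    have h2 : b ^ 2 ≤ q := by exact_mod_cast hq2
    nlinarith [Nat.mul_le_mul_left q h2, Nat.mul_le_mul hq hq, Nat.mul_le_mul (Nat.mul_le_mul hq hq)
      (Nat.le_refl (q * q))]
  obtain ⟨m, hm⟩ := Nat.exists_eq_add_of_le (show 1 + q * b ^ 2 ≤ q ^ 4 by omega)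
  have hmR : (q : ℝ) ^ 4 / 2 ≤ m := by
    have : q ^ 4 ≤ 2 * m := by omega
    have : (q : ℝ) ^ 4 ≤ 2 * m := by exact_mod_cast this
    linarith
  have hTe : ((q ^ 4 * b ^ 2 : ℕ) : ℝ) ≤ Real.exp (5 * b) := by
    push_cast
    calc (q : ℝ) ^ 4 * (b : ℝ) ^ 2 ≤ (q : ℝ) ^ 4 * q := by gcongr
      _ = (q : ℝ) ^ 5 := by ring
      _ ≤ Real.exp b ^ 5 := by gcongr
      _ = _ := by rw [← Real.exp_nat_mul]; norm_num
  have hsmall : Real.exp (-(5 * b : ℝ)) ≤ 1 / 16 := by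
    have h2 := Real.add_one_le_exp (5 * b : ℝ)
    rw [Real.exp_neg, inv_le_comm₀ (Real.exp_pos _) (by norm_num)]
    linarith
  -- With R = 20b the trivial bounds s ≤ T ≤ e^(5b) and the rate θ = 1 suffice. The assumption σ >
  -- b⁴ ≥ 240 b³ supplies 6RT ≤ mσ for m ≥ q⁴/2.
  have key := half_le_expLatency hD (n := q ^ 4) (m := m) (k := b ^ 2) (t₀ := q)
    (T := q ^ 4 * b ^ 2) (θ := 1) (R := 20 * b) (g := bitProb D) hi₀ (bitProb_nonneg D)
    (fun _ => le_rfl) le_rfl (fun i => by simpa using bitProb_le_one D i) (by positivity)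
    (by
      rw [div_le_iff₀ hp₀] at hbp
      push_cast
      have := mul_le_mul_of_nonneg_left hbp (Nat.cast_nonneg (α := ℝ) b)
      linarith)
    (by omega)
    (by
      push_cast
      calc 6 * (20 * (b : ℝ)) * ((q : ℝ) ^ 4 * (b : ℝ) ^ 2)
          = (q : ℝ) ^ 4 / 2 * (240 * (b : ℝ) ^ 3) := by ring
        _ ≤ (q : ℝ) ^ 4 / 2 * (b * (b : ℝ) ^ 3) := by gcongr
        _ = (q : ℝ) ^ 4 / 2 * (b : ℝ) ^ 4 := by ring
        _ ≤ m * ∑ i ∈ Finset.range q, bitProb D i :=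
          mul_le_mul hmR hcon.le (by positivity) (by positivity))
    (by
      calc _ ≤ Real.exp (1 - 20 * b) * Real.exp (5 * b) :=
            mul_le_mul_of_nonneg_left ((sum_bitProb_le D _).trans hTe) (Real.exp_nonneg _)
        _ = Real.exp (1 - 15 * b) := by rw [← Real.exp_add]; congr 1; ring
        _ ≤ Real.exp (-(5 * b)) := Real.exp_le_exp.2 (by linarith)
        _ ≤ _ := hsmall)
    (by
      calc _ ≤ Real.exp (5 * b) * Real.exp (-(1 * (20 * b) / 2)) :=
            mul_le_mul_of_nonneg_right hTe (Real.exp_nonneg _)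
        _ = Real.exp (-(5 * b)) := by rw [← Real.exp_add]; congr 1; ring
        _ ≤ _ := hsmall.trans (by norm_num))
    (by
      have : 0 < b := by
        have : (0 : ℝ) < b := by linarith
        exact_mod_cast this
      positivity)
  have h2 := key.trans h1
  have hlog : 1 ≤ Real.log b := by
    rw [Real.le_log_iff_exp_le (by linarith)]; linarith [Real.exp_one_lt_d9]
  have hX : 0 < (q : ℝ) ^ 4 * (b : ℝ) ^ 2 := by positivity
  rw [ENNReal.ofReal_le_ofReal_iff (by positivity)] at h2
  push_cast at h2
  have h3 : (q : ℝ) ^ 4 * (b : ℝ) ^ 2 / Real.log b ^ 2 ≤ (q : ℝ) ^ 4 * (b : ℝ) ^ 2 :=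
    div_le_self hX.le (one_le_pow₀ hlog)
  linarith

/-! ### The total of the light attempts -/

/-- The sequence of attempt probabilities with the values above `η` replaced by `0`. -/
def lightProb (D : LocalClockProtocol) (η : ℝ) (i : ℕ) : ℝ :=
  if bitProb D i ≤ η then bitProb D i else 0

lemma lightProb_nonneg (D : LocalClockProtocol) (η : ℝ) (i : ℕ) : 0 ≤ lightProb D η i := by
  unfold lightProb; split_ifs; exacts [bitProb_nonneg D i, le_rfl]

lemma lightProb_le (D : LocalClockProtocol) (η : ℝ) (i : ℕ) : lightProb D η i ≤ bitProb D i := by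
  unfold lightProb; split_ifs; exacts [le_rfl, bitProb_nonneg D i]

lemma lightProb_le_bound (D : LocalClockProtocol) {η : ℝ} (hη : 0 ≤ η) (i : ℕ) :
    lightProb D η i ≤ η := by
  unfold lightProb; split_ifs with h; exacts [h, hη]

lemma sum_lightProb_mono (D : LocalClockProtocol) (η : ℝ) {M N : ℕ} (h : M ≤ N) :
    ∑ i ∈ Finset.range M, lightProb D η i ≤ ∑ i ∈ Finset.range N, lightProb D η i :=
  Finset.sum_le_sum_of_subset_of_nonneg (Finset.range_mono h) fun i _ _ => lightProb_nonneg D η i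

lemma card_heavy_mul_le (D : LocalClockProtocol) {η : ℝ} (N : ℕ) :
    η * ((Finset.range N).filter fun i => ¬ bitProb D i ≤ η).card
      ≤ ∑ i ∈ Finset.range N, bitProb D i := by
  rw [mul_comm, ← nsmul_eq_mul]
  refine (Finset.card_nsmul_le_sum _ _ _ fun i hi => ?_).trans
    (Finset.sum_le_sum_of_subset_of_nonneg (Finset.filter_subset _ _)
      fun i _ _ => bitProb_nonneg D i)
  exact (not_le.1 (Finset.mem_filter.1 hi).2).le

lemma ceilLog_le_of_le_pow {q N j : ℕ} (hN : 0 < N) (h : N ≤ q ^ j) :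
    (ceilLog N : ℝ) ≤ j * ceilLog q + 1 := by
  have h1 : Real.log N ≤ j * Real.log q := by
    rw [← Real.log_pow]
    exact Real.log_le_log (by exact_mod_cast hN) (by exact_mod_cast h)
  have h2 := mul_le_mul_of_nonneg_left (log_le_ceilLog q) (Nat.cast_nonneg (α := ℝ) j)
  linarith [ceilLog_le_log_add_one N]

/-- Unlikely attempts contribute a logarithmic amount over each range of local times that spans a
polylogarithmic factor. -/
lemma eventually_sum_lightProb_add_le {D : LocalClockProtocol} (hD : D.IsMemoryless) {i₀ : ℕ}
    (hp₀ : 0 < bitProb D i₀) (hi₀ : ∀ i < i₀, bitProb D i = 0)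
    (hs : ∀ᶠ q : ℕ in atTop, ∑ i ∈ Finset.range q, bitProb D i ≤ (ceilLog q : ℝ) ^ 4)
    {c : ℕ} (hc : ∀ᶠ n : ℕ in atTop, ∀ L : ℕ, (n : ℝ) * (Real.log n) ^ c ≤ L →
      whpLatency D n ≤ L) :
    ∀ᶠ q : ℕ in atTop, ∀ y, q ≤ y → y ≤ q ^ 2 →
      ∑ i ∈ Finset.range y, lightProb D (((ceilLog q : ℝ) ^ 2)⁻¹) i + ceilLog q / 2 ≤
      ∑ i ∈ Finset.range (y * ceilLog q ^ (3 + 2 * c)),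
        lightProb D (((ceilLog q : ℝ) ^ 2)⁻¹) i := by
  classical
  obtain ⟨N₁, hN₁⟩ := eventually_atTop.1 hs
  obtain ⟨N₂, hN₂⟩ := eventually_atTop.1 hc
  filter_upwards [eventually_le_ceilLog 4, eventually_le_ceilLog (4 / bitProb D i₀),
    eventually_ceilLog_pow_le 1 one_pos (3 + 2 * c), eventually_ceilLog_pow_le 256 (by norm_num) 6,
    eventually_ge_atTop N₁, eventually_ge_atTop N₂, eventually_gt_atTop 0]
    with q hb hbp hqr hq6 hqN₁ hqN₂ hq y hqy hyq
  set b := ceilLog q with hbdef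
  set η : ℝ := ((b : ℝ) ^ 2)⁻¹ with hη
  -- The factor b³ gives the number ν = y b³ of parties, and b^(2c) dominates (log ν)^c since log ν
  -- ≤ 3b ≤ b².
  set r := b ^ (3 + 2 * c) with hr
  have hb4 : 4 ≤ b := by exact_mod_cast hb
  rw [one_mul] at hqr
  have hrq : r ≤ q := by exact_mod_cast hqr
  have hr1 : 1 ≤ r := Nat.one_le_pow _ _ (by omega)
  have hb3r : b ^ 3 ≤ r := Nat.pow_le_pow_right (by omega) (by omega)
  have hb1 : 1 ≤ b ^ 3 := Nat.one_le_pow _ _ (by omega)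
  have hy0 : 0 < y := by omega
  have hyr3 : y * r ≤ q ^ 3 := by
    calc y * r ≤ q ^ 2 * q := Nat.mul_le_mul hyq hrq
      _ = q ^ 3 := by ring
  have hyyr : y ≤ y * r := Nat.le_mul_of_pos_right y hr1
  have hylt : 0 < y * r := by omega
  set H := (Finset.range (y * r)).filter fun i => ¬ bitProb D i ≤ η with hH
  -- The polylogarithmic total gives |H| ≤ 256 b⁶ ≤ q ≤ y, so blocking W with b² parties per time
  -- fits within ν.
  set W := Finset.range y ∪ H with hW
  have hHcard : (H.card : ℝ) ≤ q := by
    have h1 := card_heavy_mul_le D (η := η) (y * r)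
    have h2 := hN₁ (y * r) (by omega)
    have h3 : (ceilLog (y * r) : ℝ) ≤ 4 * b := by
      have := ceilLog_le_of_le_pow hylt hyr3
      push_cast at this
      linarith
    have h4 : (ceilLog (y * r) : ℝ) ^ 4 ≤ (4 * b) ^ 4 := by gcongr
    have h5 : η * H.card ≤ (4 * b) ^ 4 := h1.trans (h2.trans h4)
    rw [hη, inv_mul_le_iff₀ (by positivity)] at h5
    refine h5.trans (le_trans (le_of_eq ?_) hq6)
    ring
  have hWcard : W.card ≤ 2 * y := by
    have h1 := Finset.card_union_le (Finset.range y) H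
    have h2 : H.card ≤ q := by exact_mod_cast hHcard
    rw [Finset.card_range, ← hW] at h1
    omega
  set ν := y * b ^ 3 with hν
  have hνy : y ≤ ν := Nat.le_mul_of_pos_right y hb1
  have hν3 : ν ≤ q ^ 3 := (Nat.mul_le_mul_left y hb3r).trans hyr3
  have hlogν : Real.log ν ≤ 3 * b := by
    have h1 : Real.log ν ≤ (3 : ℕ) * Real.log q := by
      rw [← Real.log_pow]
      exact Real.log_le_log (by exact_mod_cast (by omega : 0 < ν)) (by exact_mod_cast hν3)
    push_cast at h1
    linarith [log_le_ceilLog q]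
  have hlogν' : Real.log q ≤ Real.log ν :=
    Real.log_le_log (by exact_mod_cast hq) (by exact_mod_cast hqy.trans hνy)
  have hlogq : (b : ℝ) - 1 ≤ Real.log q := by linarith [ceilLog_le_log_add_one q]
  have hwhp : whpLatency D ν ≤ (y * r : ℕ) := by
    refine hN₂ ν (by omega) _ ?_
    have h1 : Real.log ν ≤ (b : ℝ) ^ 2 := by nlinarith
    calc (ν : ℝ) * Real.log ν ^ c ≤ ν * ((b : ℝ) ^ 2) ^ c :=
          mul_le_mul_of_nonneg_left (pow_le_pow_left₀ (by linarith) h1 c) (Nat.cast_nonneg _)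
      _ = _ := by rw [hν, hr]; push_cast; ring
  have hη2 : η ≤ 1 / 2 := by
    rw [hη, inv_le_comm₀ (by positivity) (by norm_num)]; nlinarith
  -- Since b p(i₀) ≥ 4, b² blockers are all silent with probability at most e^(-4b), against |W| ≤
  -- 2e^(2b).
  have hpow : (W.card : ℝ) * (1 - bitProb D i₀) ^ b ^ 2 ≤ 1 / 2 := by
    have h1 : (1 - bitProb D i₀) ^ b ^ 2 ≤ Real.exp (-(4 * b)) := by
      have h2 : 1 - bitProb D i₀ ≤ Real.exp (-bitProb D i₀) := by
        linarith [Real.add_one_le_exp (-bitProb D i₀)]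
      refine (pow_le_pow_left₀ (by linarith [bitProb_le_one D i₀]) h2 _).trans ?_
      rw [← Real.exp_nat_mul, Real.exp_le_exp]
      rw [div_le_iff₀ hp₀] at hbp
      push_cast
      have := mul_le_mul_of_nonneg_left hbp (Nat.cast_nonneg (α := ℝ) b)
      linarith
    have h3 : (W.card : ℝ) ≤ 2 * Real.exp (2 * b) := by
      have h4 : (W.card : ℝ) ≤ 2 * (q : ℝ) ^ 2 := by
        exact_mod_cast hWcard.trans (Nat.mul_le_mul_left 2 hyq)
      refine h4.trans (mul_le_mul_of_nonneg_left ?_ (by norm_num))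
      calc (q : ℝ) ^ 2 ≤ Real.exp b ^ 2 := by
            have := le_exp_ceilLog hq
            gcongr
        _ = _ := by rw [← Real.exp_nat_mul]; norm_num
    calc _ ≤ 2 * Real.exp (2 * b) * Real.exp (-(4 * b)) :=
          mul_le_mul h3 h1 (pow_nonneg (by linarith [bitProb_le_one D i₀]) _) (by positivity)
      _ = 2 * (Real.exp (2 * b))⁻¹ := by
          rw [mul_assoc, ← Real.exp_add, ← Real.exp_neg]; congr 2; ring
      _ ≤ 2 * (4 : ℝ)⁻¹ := by
          have := Real.add_one_le_exp (2 * b : ℝ)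
          gcongr
          linarith
      _ = _ := by norm_num
  have key := log_sub_one_le_sum hD hi₀ W (n := ν) (k := b ^ 2) (L := y * r) (by
      have h1 := Nat.mul_le_mul_right (b ^ 2) hWcard
      have h2 : 4 * (y * b ^ 2) ≤ ν := by
        rw [hν]
        calc 4 * (y * b ^ 2) ≤ b * (y * b ^ 2) := Nat.mul_le_mul_right _ hb4
          _ = _ := by ring
      have h3 : 0 < y * b ^ 2 := by positivity
      nlinarith) hwhp (fun i hi hlt => by
      have : i ∉ H := fun h => hi (Finset.mem_union_right _ h)
      simp only [hH, Finset.mem_filter, Finset.mem_range, hlt, true_and, not_not] at this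
      exact this.trans hη2) hpow
  have hsum : ∑ i ∈ Finset.range (y * r) \ W, bitProb D i ≤
      ∑ i ∈ Finset.range (y * r) \ Finset.range y, lightProb D η i := by
    rw [Finset.sum_congr rfl (g := fun i => lightProb D η i) fun i hi => ?_]
    · refine Finset.sum_le_sum_of_subset_of_nonneg (Finset.sdiff_subset_sdiff le_rfl
        Finset.subset_union_left) fun i _ _ => lightProb_nonneg D η i
    · rw [Finset.mem_sdiff] at hi
      have : i ∉ H := fun h => hi.2 (Finset.mem_union_right _ h)
      simp only [hH, Finset.mem_filter, hi.1, true_and, not_not] at this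
      simp [lightProb, this]
  have hsplit := Finset.sum_sdiff (f := fun i => lightProb D η i) (Finset.range_mono hyyr)
  linarith

/-- The total of the unlikely attempts is nearly quadratic in the logarithm of the local time. -/
lemma eventually_le_sum_lightProb {D : LocalClockProtocol} {d : ℕ} (hd : 0 < d)
    (h : ∀ᶠ q : ℕ in atTop, ∀ y, q ≤ y → y ≤ q ^ 2 →
      ∑ i ∈ Finset.range y, lightProb D (((ceilLog q : ℝ) ^ 2)⁻¹) i + ceilLog q / 2 ≤
      ∑ i ∈ Finset.range (y * ceilLog q ^ d), lightProb D (((ceilLog q : ℝ) ^ 2)⁻¹) i) :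
    ∀ᶠ q : ℕ in atTop, (ceilLog q : ℝ) ^ 2 / (8 * d * Real.log (ceilLog q)) ≤
      ∑ i ∈ Finset.range (q ^ 2), lightProb D (((ceilLog q : ℝ) ^ 2)⁻¹) i := by
  have hlogo : ∀ᶠ q : ℕ in atTop, 4 * d * Real.log (ceilLog q) ≤ ceilLog q := by
    have h1 := (Real.isLittleO_log_id_atTop.bound
      (show (0 : ℝ) < 1 / (4 * d) by positivity)).filter_mono
      (tendsto_natCast_atTop_atTop.comp tendsto_ceilLog)
    filter_upwards [tendsto_map.eventually h1, eventually_le_ceilLog 1] with q h2 h3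
    simp only [Function.comp_apply, id, Real.norm_eq_abs] at h2
    rw [abs_of_nonneg (Real.log_nonneg h3), abs_of_nonneg (by positivity)] at h2
    have h4 : (0 : ℝ) < 4 * d := by positivity
    calc 4 * d * Real.log (ceilLog q) ≤ 4 * d * (1 / (4 * d) * ceilLog q) :=
          mul_le_mul_of_nonneg_left h2 h4.le
      _ = _ := by field_simp
  filter_upwards [h, hlogo, eventually_le_ceilLog 4, eventually_gt_atTop 0] with q h hlo hb hq
  set b := ceilLog q with hbdef
  set r := b ^ d with hr
  have hb0 : 0 < b := by
    have : (0 : ℝ) < b := by linarith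
    exact_mod_cast this
  set l := Real.log b with hl
  have hlpos : 0 < l := Real.log_pos (by linarith)
  have hdl : 0 < d * l := by positivity
  have hlogq : (b : ℝ) - 1 ≤ Real.log q := by linarith [ceilLog_le_log_add_one q]
  -- The number of factors b^d that fit between q and q²; each contributes b/2.
  set J := ⌊Real.log q / (d * l)⌋₊ with hJ
  have hrJ : r ^ J ≤ q := by
    have h1 : (J : ℝ) ≤ Real.log q / (d * l) :=
      Nat.floor_le (div_nonneg (Real.log_natCast_nonneg q) hdl.le)
    rw [le_div_iff₀ hdl] at h1
    have h2 : ((r ^ J : ℕ) : ℝ) ≤ q := by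
      rw [← Real.log_le_log_iff (by positivity) (by exact_mod_cast hq), hr]
      push_cast
      rw [Real.log_pow, Real.log_pow]
      exact h1
    exact_mod_cast h2
  have hr1 : 1 ≤ r := Nat.one_le_pow _ _ hb0
  have hind : ∀ j ≤ J, (j : ℝ) * (b / 2) ≤
      ∑ i ∈ Finset.range (q * r ^ j), lightProb D (((b : ℝ) ^ 2)⁻¹) i := by
    intro j
    induction j with
    | zero =>
      intro _
      rw [Nat.cast_zero, zero_mul]
      exact Finset.sum_nonneg fun i _ => lightProb_nonneg D _ i
    | succ j ih =>
      intro hj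
      have h1 := ih (by omega)
      have h2 := h (q * r ^ j) (Nat.le_mul_of_pos_right q (Nat.one_le_pow _ _ hr1)) (by
        rw [pow_two]
        exact Nat.mul_le_mul_left q ((Nat.pow_le_pow_right hr1 (by omega)).trans hrJ))
      rw [pow_succ, ← mul_assoc]
      push_cast
      linarith
  refine le_trans ?_ ((hind J le_rfl).trans (sum_lightProb_mono D _ (by
    rw [pow_two]; exact Nat.mul_le_mul_left q hrJ)))
  have hJge : (b : ℝ) / (4 * (d * l)) ≤ J := by
    have h1 := Nat.sub_one_lt_floor (Real.log q / (d * l))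
    rw [← hJ] at h1
    refine le_trans ?_ h1.le
    rw [div_le_iff₀ (by positivity), sub_mul]
    have e : Real.log q / (d * l) * (4 * (d * l)) = 4 * Real.log q := by field_simp
    rw [e]
    linarith
  calc (b : ℝ) ^ 2 / (8 * d * l) = b / (4 * (d * l)) * (b / 2) := by field_simp; ring
    _ ≤ _ := mul_le_mul_of_nonneg_right hJge (by positivity)


/-! ### The final flooding and the contradiction -/

/-- If the unlikely attempts have a total that is nearly quadratic in the logarithm of the local
time, while all attempts together remain polylogarithmic, then the expected latency is large. -/
lemma not_isLittleOTop_expLatency {D : LocalClockProtocol} (hD : D.IsMemoryless) {i₀ d : ℕ}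
    (hp₀ : 0 < bitProb D i₀) (hi₀ : ∀ i < i₀, bitProb D i = 0) (hd : 0 < d)
    (hs : ∀ᶠ q : ℕ in atTop, ∑ i ∈ Finset.range q, bitProb D i ≤ (ceilLog q : ℝ) ^ 4)
    (hσ : ∀ᶠ q : ℕ in atTop, (ceilLog q : ℝ) ^ 2 / (8 * d * Real.log (ceilLog q)) ≤
      ∑ i ∈ Finset.range (q ^ 2), lightProb D (((ceilLog q : ℝ) ^ 2)⁻¹) i) :
    ¬ IsLittleOTop (fun n => expLatency D n)
      (fun n => (n : ℝ) * (Real.log n) ^ 2 / (Real.log (Real.log n)) ^ 2) := by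
  intro h
  have hdR : (1 : ℝ) ≤ d := by exact_mod_cast hd
  -- Chosen so that 6·8l·κX equals (q⁴/2)·b²/(8dl), the available total contention.
  set κ : ℝ := 1 / (768 * d) with hκ
  have hκ0 : 0 < κ := by positivity
  obtain ⟨N, hN⟩ := eventually_atTop.1 hs
  obtain ⟨q, h1, hσ, hb, hbp, hq2, hqκ, hqN, hq⟩ :=
    ((eventually_expLatency_pow_le h (show (0 : ℝ) < κ / 128 by positivity)).and
    (hσ.and ((eventually_le_ceilLog 500).and ((eventually_le_ceilLog (8 / bitProb D i₀)).and
    ((eventually_ceilLog_pow_le 1 one_pos 2).and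
    ((tendsto_natCast_atTop_atTop.eventually_ge_atTop (2 / κ)).and
    ((eventually_ge_atTop N).and (eventually_ge_atTop 2)))))))).exists
  set b := ceilLog q with hbdef
  have hqR : (2 : ℝ) ≤ q := by exact_mod_cast hq
  have hq0 : 0 < q := by omega
  rw [one_mul] at hq2
  have hb2q : b ^ 2 ≤ q := by exact_mod_cast hq2
  have hqe := le_exp_ceilLog hq0
  rw [← hbdef] at hqe
  set l := Real.log b with hl
  have hl1 : 1 ≤ l := by
    rw [hl, Real.le_log_iff_exp_le (by linarith)]; linarith [Real.exp_one_lt_d9]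
  have hlb : l ≤ b := by
    have := Real.log_le_sub_one_of_pos (show (0 : ℝ) < b by linarith)
    linarith
  have hexpl : Real.exp l = b := Real.exp_log (by linarith)
  set X : ℝ := (q : ℝ) ^ 4 * (b : ℝ) ^ 2 / l ^ 2 with hX
  have hXq : (q : ℝ) ≤ X := by
    rw [hX, le_div_iff₀ (by positivity)]
    have h2 : l ^ 2 ≤ (b : ℝ) ^ 2 := by gcongr
    have h3 : (q : ℝ) ≤ (q : ℝ) ^ 4 := le_self_pow₀ (by linarith) (by norm_num)
    exact mul_le_mul h3 h2 (by positivity) (by positivity)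
  have hκX : 2 ≤ κ * X := by
    rw [div_le_iff₀ hκ0] at hqκ
    have := mul_le_mul_of_nonneg_left hXq hκ0.le
    linarith
  set T := ⌊κ * X⌋₊ with hT
  have hTle : (T : ℝ) ≤ κ * X := Nat.floor_le (by linarith)
  have hTge : κ * X / 2 ≤ T := by
    have := Nat.sub_one_lt_floor (κ * X)
    rw [← hT] at this
    linarith
  have hTpos : 0 < T := by
    have : (0 : ℝ) < T := by linarith
    exact_mod_cast this
  have hT5 : T ≤ q ^ 5 := by
    have h2 : κ * X ≤ X := mul_le_of_le_one_left (by linarith) (by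
      rw [hκ, div_le_one (by positivity)]; linarith)
    have h3 : X ≤ (q : ℝ) ^ 4 * (b : ℝ) ^ 2 := div_le_self (by positivity) (one_le_pow₀ hl1)
    have h4 : (q : ℝ) ^ 4 * (b : ℝ) ^ 2 ≤ (q : ℝ) ^ 5 := by
      calc (q : ℝ) ^ 4 * (b : ℝ) ^ 2 ≤ (q : ℝ) ^ 4 * q := by gcongr
        _ = _ := by ring
    have : (T : ℝ) ≤ ((q ^ 5 : ℕ) : ℝ) := by push_cast; linarith
    exact_mod_cast this
  have hsT : ∑ i ∈ Finset.range T, bitProb D i ≤ 1296 * (b : ℝ) ^ 4 := by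
    have hq5 : 0 < q ^ 5 := by positivity
    refine (sum_bitProb_mono D hT5).trans ((hN (q ^ 5) (hqN.trans
      (Nat.le_self_pow (by norm_num) q))).trans ?_)
    have h2 : (ceilLog (q ^ 5) : ℝ) ≤ 6 * b := by
      have := ceilLog_le_of_le_pow hq5 (le_refl (q ^ 5))
      push_cast at this
      linarith
    calc (ceilLog (q ^ 5) : ℝ) ^ 4 ≤ (6 * b) ^ 4 := by gcongr
      _ = _ := by ring
  have hsize : 2 * (1 + q ^ 2 * b ^ 2) ≤ q ^ 4 := by
    have h2 : 500 * 500 ≤ b ^ 2 := by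
      rw [pow_two]
      have : 500 ≤ b := by exact_mod_cast hb
      exact Nat.mul_le_mul this this
    have h3 : q ^ 2 * b ^ 2 ≤ q ^ 2 * q := Nat.mul_le_mul_left _ hb2q
    have h4 : 4 * (q ^ 2 * q) ≤ q * (q ^ 2 * q) := Nat.mul_le_mul_right _ (by omega)
    have h5 : 1 ≤ q ^ 2 * q := Nat.one_le_iff_ne_zero.2 (by positivity)
    calc 2 * (1 + q ^ 2 * b ^ 2) ≤ 4 * (q ^ 2 * q) := by omega
      _ ≤ q * (q ^ 2 * q) := h4
      _ = q ^ 4 := by ring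
  obtain ⟨m, hm⟩ := Nat.exists_eq_add_of_le (show 1 + q ^ 2 * b ^ 2 ≤ q ^ 4 by omega)
  have hmR : (q : ℝ) ^ 4 / 2 ≤ m := by
    have : q ^ 4 ≤ 2 * m := by omega
    have : (q : ℝ) ^ 4 ≤ 2 * m := by exact_mod_cast this
    linarith
  have hb2pos : (0 : ℝ) < (b : ℝ) ^ 2 := by positivity
  have hη0 : 0 ≤ ((b : ℝ) ^ 2)⁻¹ := by positivity
  -- R = 8l makes e^(1-R) = e·b⁻⁸, which beats s ≤ 1296 b⁴. Light probabilities permit θ = b², so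
  -- θR/2 = 4b²l exceeds log T ≤ 5b.
  have key := half_le_expLatency hD (n := q ^ 4) (m := m) (k := b ^ 2) (t₀ := q ^ 2)
    (T := T) (θ := (b : ℝ) ^ 2) (R := 8 * l) (g := lightProb D (((b : ℝ) ^ 2)⁻¹)) hi₀
    (lightProb_nonneg D _) (lightProb_le D _) (one_le_pow₀ (by linarith))
    (fun i => by
      have := mul_le_mul_of_nonneg_left (lightProb_le_bound D hη0 i) hb2pos.le
      rwa [mul_inv_cancel₀ hb2pos.ne'] at this)
    (by linarith)
    (by
      rw [div_le_iff₀ hp₀] at hbp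
      push_cast
      have := mul_le_mul_of_nonneg_left hbp (Nat.cast_nonneg (α := ℝ) b)
      linarith)
    (by omega)
    (by
      calc 6 * (8 * l) * T ≤ 6 * (8 * l) * (κ * X) :=
            mul_le_mul_of_nonneg_left hTle (by linarith)
        _ = (q : ℝ) ^ 4 / 2 * ((b : ℝ) ^ 2 / (8 * d * l)) := by
            rw [hκ, hX]; field_simp; norm_num
        _ ≤ _ := mul_le_mul hmR hσ (by positivity) (by positivity))
    (by
      have e : Real.exp (1 - 8 * l) = Real.exp 1 / (b : ℝ) ^ 8 := by
        rw [Real.exp_sub, ← hexpl, ← Real.exp_nat_mul]; norm_num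
      have hbb : (500 : ℝ) ^ 4 ≤ (b : ℝ) ^ 4 := by gcongr
      rw [e]
      calc _ ≤ Real.exp 1 / (b : ℝ) ^ 8 * (1296 * (b : ℝ) ^ 4) :=
            mul_le_mul_of_nonneg_left hsT (by positivity)
        _ = Real.exp 1 * 1296 / (b : ℝ) ^ 4 := by field_simp
        _ ≤ _ := by
          rw [div_le_iff₀ (by positivity)]
          linarith [Real.exp_one_lt_d9])
    (by
      have hTe : (T : ℝ) ≤ Real.exp (5 * b) := by
        calc (T : ℝ) ≤ (q : ℝ) ^ 5 := by exact_mod_cast hT5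
          _ ≤ Real.exp b ^ 5 := by gcongr
          _ = _ := by rw [← Real.exp_nat_mul]; norm_num
      have h2 : (6 * b : ℝ) ≤ (b : ℝ) ^ 2 * (8 * l) / 2 := by
        have h3 : (b : ℝ) ^ 2 * 1 ≤ (b : ℝ) ^ 2 * l := mul_le_mul_of_nonneg_left hl1 hb2pos.le
        nlinarith
      calc _ ≤ Real.exp (5 * b) * Real.exp (-(6 * b)) :=
            mul_le_mul hTe (Real.exp_le_exp.2 (by linarith)) (Real.exp_nonneg _)
              (Real.exp_nonneg _)
        _ = (Real.exp b)⁻¹ := by rw [← Real.exp_add, ← Real.exp_neg]; congr 1; ring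
        _ ≤ (4 : ℝ)⁻¹ := by
            have := Real.add_one_le_exp (b : ℝ)
            gcongr
            linarith
        _ = _ := by norm_num)
    hTpos
  -- The lower bound T/2 ≥ κX/4 meets the upper bound κX/8.
  have h2 := key.trans h1
  rw [ENNReal.ofReal_le_ofReal_iff (by positivity)] at h2
  have e : κ / 128 * (16 * X) = κ * X / 8 := by ring
  rw [e] at h2
  linarith

end ContentionResolution

end

theorem mainTheorem3 (D : ContentionResolution.LocalClockProtocol) (hD : D.IsMemoryless) :
    ¬ (ContentionResolution.IsLittleOTop (fun n => ContentionResolution.expLatency D n)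
          (fun n => (n : ℝ) * (Real.log n) ^ 2 / (Real.log (Real.log n)) ^ 2) ∧
        ContentionResolution.IsNPolylog
          (fun n => ((ContentionResolution.whpLatency D n : ℕ∞) : ENNReal))) := by
  rintro ⟨hexp, hwhp⟩
  obtain ⟨i₀, hp₀, hi₀⟩ := ContentionResolution.exists_first_attempt hD hwhp
  obtain ⟨c, hc⟩ := ContentionResolution.exists_latency_exponent hwhp
  have hs := ContentionResolution.eventually_sum_bitProb_le hD hp₀ hi₀ hexp
  have hσ := ContentionResolution.eventually_le_sum_lightProb (show 0 < 3 + 2 * c by omega)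
    (ContentionResolution.eventually_sum_lightProb_add_le hD hp₀ hi₀ hs hc)
  exact ContentionResolution.not_isLittleOTop_expLatency hD hp₀ hi₀ (by omega) hs hσ hexp
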